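/- Let $I=(0,1]$ with Lebesgue measure $\lambda$; all functions are real and $L^p=L^p(I,\lambda)$. An order ideal is a vector space $X$ with $L^\infty\subseteq X\subseteq L^1$ such that $x\in X$, $y\in L^1$, $|y|\le|x|$ a.e. imply $y\in X$. A Banach ideal is an order ideal with a complete norm such that $|y|\le|x|$ a.e. implies $\|y\|_X\le\|x\|_X$, and $\|x\|_{L^1}\le\|x\|_X\le\|x\|_{L^\infty}$ for all $x\in X$ (where $\|x\|_{L^\infty}=\infty$ if $x\notin L^\infty$). A bounded linear operator $T:L^1\to L^1$ is admissible if $T(L^\infty)\subseteq L^\infty$; it is double stochastic if moreover it is positive, $T\mathbf 1=\mathbf 1$ and $\int_I Tf\,d\lambda=\int_I f\,d\lambda$ for all $f\in L^1$. The Ryff orbit of $x\in L^1$ is $\Omega_x=\{Tx: T \text{ double stochastic}\}$. An order ideal $X$ is majorant if $TX\subseteq X$ for every admissible $T$ (that is, $X$ is an $(L^1,L^\infty)$ interpolation space); a Banach ideal $X$ is strongly majorant if every admissible $T$ maps $X$ into itself with $\|T\|_{X\to X}\le\max(\|T\|_{L^1\to L^1},\|T\|_{L^\infty\to L^\infty})$.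 For an at most countable measurable partition $\mathcal F$ of $I$, let $E(\cdot|\mathcal F)$ be the conditional expectation with respect to the $\sigma$-algebra generated by $\mathcal F$. **Theorem 3.2.** I. Let $X$ be an order ideal such that $E(X|\mathcal F)\subseteq X$ for every at most countable partition $\mathcal F$. Then $\Omega_x\subseteq X$ for every $x\in X$, and $X$ is a majorant ideal. II. Let $(X,\|\cdot\|_X)$ be a Banach ideal such that, for every at most countable partition $\mathcal F$, $E(X|\mathcal F)\subseteq X$ and $\|E(\cdot|\mathcal F)\|_{X\to X}\le1$. Then $(X,\|\cdot\|_X)$ is strongly majorant. In particular it suffices to test double stochastic projections: an order ideal $X$ is majorant if and only if $PX\subseteq X$ for every double stochastic projection $P$ (double stochastic $P$ with $P^2=P$), and a Banach ideal $X$ is strongly majorant if and only if every double stochastic projection $P$ maps $X$ into itself with $\|P\|_{X\to X}\le1$. -/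

import Mathlib

open MeasureTheory Filter Topology
open scoped ENNReal

namespace AveragingIdeals

/-- Lebesgue measure on the interval `I = (0, 1]`. -/
noncomputable abbrev lam : Measure ℝ := volume.restrict (Set.Ioc (0 : ℝ) 1)

/-- The real space `L¹(I)` (classes of a.e. equal functions). -/
abbrev L1I : Type := Lp ℝ 1 lam

/-- The constant function `1`, as an element of `L¹(I)`. -/
noncomputable def oneL1 : L1I := Lp.const 1 lam (1 : ℝ)

/-- The `L^∞(I)`-norm of an element of `L¹(I)`; it is `∞` if the element is not bounded. -/
noncomputable def supNorm (f : L1I) : ℝ≥0∞ := eLpNorm (f : ℝ → ℝ) ∞ lam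

/-- An order ideal in `L¹(I)`: a vector space `X` with `L^∞(I) ⊆ X ⊆ L¹(I)` such that
`x ∈ X` and `|y| ≤ |x|` imply `y ∈ X`. -/
structure IsOrderIdeal (X : Submodule ℝ L1I) : Prop where
  bounded_mem : ∀ f : L1I, supNorm f < ∞ → f ∈ X
  solid : ∀ x y : L1I, x ∈ X → |y| ≤ |x| → y ∈ X

/-- `(X, N)` is a Banach ideal in `L¹(I)`: `X` is an order ideal, and `N` is an order monotonic
complete norm on `X` with `‖x‖_{L¹} ≤ N x ≤ ‖x‖_{L^∞}` for all `x ∈ X`. (A seminorm that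
dominates the `L¹`-norm is a norm.) -/
structure IsBanachIdeal (X : Submodule ℝ L1I) (N : Seminorm ℝ X) : Prop where
  ideal : IsOrderIdeal X
  l1_le : ∀ x : X, ‖(x : L1I)‖ ≤ N x
  le_sup : ∀ x : X, ENNReal.ofReal (N x) ≤ supNorm (x : L1I)
  monotonic : ∀ x y : X, |(y : L1I)| ≤ |(x : L1I)| → N y ≤ N x
  complete : ∀ u : ℕ → X,
    (∀ ε : ℝ, 0 < ε → ∃ n₀ : ℕ, ∀ m n : ℕ, n₀ ≤ m → n₀ ≤ n → N (u m - u n) < ε) →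
    ∃ x : X, Tendsto (fun n => N (u n - x)) atTop (𝓝 0)

/-- An at most countable measurable partition of `I`. Cells may be empty (this covers the finite
partitions) or null. Borel cells suffice, as a Lebesgue measurable set differs from a Borel set
by a null set and averaging does not see null sets. -/
structure CountablePartition where
  cell : ℕ → Set ℝ
  measurable_cell : ∀ n, MeasurableSet (cell n)
  disjoint_cell : Pairwise fun m n => Disjoint (cell m) (cell n)
  iUnion_cell : ⋃ n, cell n = Set.Ioc (0 : ℝ) 1

/-- The `σ`-algebra generated by the cells of a partition. -/
abbrev CountablePartition.sigma (F : CountablePartition) : MeasurableSpace ℝ :=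
  MeasurableSpace.generateFrom (Set.range F.cell)

theorem CountablePartition.sigma_le (F : CountablePartition) :
    F.sigma ≤ (inferInstance : MeasurableSpace ℝ) := by
  refine MeasurableSpace.generateFrom_le ?_
  rintro _ ⟨n, rfl⟩
  exact F.measurable_cell n

/-- The averaging operator `E(· | F) : L¹(I) → L¹(I)`, i.e. the conditional expectation with
respect to the `σ`-algebra generated by the partition `F`. -/
noncomputable def CountablePartition.avg (F : CountablePartition) : L1I →L[ℝ] L1I :=
  condExpL1CLM ℝ F.sigma_le lam

/-- The operator `T` maps `X` into itself. -/
def Preserves (T : L1I →L[ℝ] L1I) (X : Submodule ℝ L1I) : Prop :=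
  ∀ x ∈ X, T x ∈ X

/-- The operator `T` maps `X` into itself and `‖T‖_{X → X} ≤ C` for the norm `N` on `X`. -/
def NormLeOn (T : L1I →L[ℝ] L1I) (X : Submodule ℝ L1I) (N : Seminorm ℝ X) (C : ℝ≥0∞) : Prop :=
  ∀ x : X, ∃ h : T (x : L1I) ∈ X,
    ENNReal.ofReal (N ⟨T (x : L1I), h⟩) ≤ C * ENNReal.ofReal (N x)

/-- An admissible operator: a bounded linear operator on `L¹(I)` that maps `L^∞(I)` into
itself. -/
def IsAdmissible (T : L1I →L[ℝ] L1I) : Prop :=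
  ∀ f : L1I, supNorm f < ∞ → supNorm (T f) < ∞

/-- The operator norm `‖T‖_{L^∞ → L^∞}`. -/
noncomputable def supOpNorm (T : L1I →L[ℝ] L1I) : ℝ≥0∞ :=
  ⨆ (f : L1I) (_ : supNorm f ≤ 1), supNorm (T f)

/-- A double stochastic operator: positive, admissible, `T 1 = 1` and `T^* 1 = 1`. The last
condition says that `∫ (T f) · 1 = ∫ f · 1` for all `f ∈ L¹(I)`. -/
structure IsDoubleStochastic (T : L1I →L[ℝ] L1I) : Prop where
  admissible : IsAdmissible T
  positive : ∀ f : L1I, 0 ≤ f → 0 ≤ T f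
  map_one : T oneL1 = oneL1
  adjoint_one : ∀ f : L1I, ∫ t, T f t ∂lam = ∫ t, f t ∂lam

/-- A double stochastic projection: a double stochastic operator `P` with `P² = P`. -/
structure IsDoubleStochasticProjection (P : L1I →L[ℝ] L1I) : Prop where
  doubleStochastic : IsDoubleStochastic P
  idempotent : ∀ f : L1I, P (P f) = P f

/-- The Ryff orbit of `x`: the set of all `T x`, where `T` is double stochastic. -/
def ryffOrbit (x : L1I) : Set L1I :=
  {y | ∃ T : L1I →L[ℝ] L1I, IsDoubleStochastic T ∧ y = T x}

/-- A majorant ideal: an order ideal that is an interpolation space between `L¹(I)` and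
`L^∞(I)`, i.e. it is mapped into itself by every admissible operator. -/
structure IsMajorantIdeal (X : Submodule ℝ L1I) : Prop where
  ideal : IsOrderIdeal X
  interpolation : ∀ T : L1I →L[ℝ] L1I, IsAdmissible T → Preserves T X

/-- A strongly majorant ideal: a Banach ideal that is a strongly interpolation space, i.e. every
admissible operator `T` maps `X` into itself and
`‖T‖_{X → X} ≤ max (‖T‖_{L¹ → L¹}, ‖T‖_{L^∞ → L^∞})`. -/
structure IsStronglyMajorant (X : Submodule ℝ L1I) (N : Seminorm ℝ X) : Prop where
  banachIdeal : IsBanachIdeal X N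
  interpolation : ∀ T : L1I →L[ℝ] L1I, IsAdmissible T →
    NormLeOn T X N (max ‖T‖ₑ (supOpNorm T))

end AveragingIdeals

/-! Define the gauge of a nonnegative function as the infimum of the norms of the elements of X that
dominate it, with value ∞ if there are none. By the hypothesis on conditional expectations,
averaging a function over a countable partition does not increase this gauge
(`isAveragingGauge_dominationGauge`). The core is a statement about all such gauges M: M(|Tx|) ≤ C ·
M(|x|) whenever C bounds both norms of T (`IsAveragingGauge.enorm_apply_le`). Part I is the case of
the seminorm 0, where the gauge is 0 or ∞.

To bound T, cut |x| and |Tx| along geometric level sets A i and B n. Up to factors near 1 both are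
step functions, and T/C yields a matrix k n i of masses with row sums ≤ μ(B n) and column sums ≤ μ(A
i). Split A i and B n into pieces of measure k n i, carry the values from the pieces of A i to those
of B n, and average over B n: the result dominates |Tx|/C. So the crux is that moving values between
sets of equal measure does not increase M (`IsAveragingGauge.rearrange`).

A single average over two equal cells only mixes their values evenly. But mixing halves in turn, as
in a counterflow heat exchanger, exchanges the values almost completely: the weight p of a cell's
own value drops to p - p² + p³ (`Exchanges.counterflow`), hence tends to 0. By nonnegativity only
the factor q = 1 - p is lost. All errors are factors tending to 1, so superhomogeneity of M replaces
any continuity.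

For the tests by projections: averaging operators are double stochastic projections, and double
stochastic operators have both norms at most 1. -/

namespace AveragingIdeals

open Set
open scoped NNReal

/-! ### Sets of prescribed measure. -/

section Splitting

variable {μ : Measure ℝ} [IsFiniteMeasure μ] [NullSingletonClass μ]

theorem continuous_measureReal_Iic (ν : Measure ℝ) [IsFiniteMeasure ν] [NullSingletonClass ν] :
    Continuous fun t => ν.real (Iic t) := by
  have h : (fun t => ν.real (Iic t)) = fun t => ∫ s, (Iic t).indicator (fun _ => (1 : ℝ)) s ∂ν := by
    funext t
    rw [integral_indicator measurableSet_Iic]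
    simp
  rw [h, continuous_iff_continuousAt]
  intro t₀
  refine continuousAt_of_dominated (bound := fun _ => 1) ?_ ?_ (integrable_const _) ?_
  · exact Eventually.of_forall fun t =>
      (measurable_const.indicator measurableSet_Iic).aestronglyMeasurable
  · refine Eventually.of_forall fun t => ae_of_all _ fun s => ?_
    by_cases hs : s ∈ Iic t <;> simp [hs]
  · filter_upwards [Measure.ae_ne ν t₀] with s hs
    rcases lt_or_gt_of_ne hs with hs | hs
    · refine (continuousAt_const (y := (1 : ℝ))).congr ?_
      filter_upwards [lt_mem_nhds hs] with t ht
      simp [ht.le]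
    · refine (continuousAt_const (y := (0 : ℝ))).congr ?_
      filter_upwards [gt_mem_nhds hs] with t ht
      simp [ht]

/-- A finite measure on the line without point masses takes all intermediate values. -/
theorem exists_subset_measure_eq {S : Set ℝ} (hS : MeasurableSet S) {w : ℝ≥0∞} (hw : w ≤ μ S) :
    ∃ E ⊆ S, MeasurableSet E ∧ μ E = w := by
  rcases eq_or_ne w 0 with rfl | hw0
  · exact ⟨∅, empty_subset _, MeasurableSet.empty, by simp⟩
  rcases eq_or_lt_of_le hw with rfl | hlt
  · exact ⟨S, Subset.rfl, hS, rfl⟩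
  set ν := μ.restrict S
  have hw' : w ≠ ∞ := (hw.trans_lt (measure_lt_top μ S)).ne
  have hbot : Tendsto (fun t => ν (Iic t)) atBot (𝓝 0) := by
    have h := tendsto_measure_iInter_atBot (μ := ν) (s := fun t : ℝ => Iic t)
      (fun t => measurableSet_Iic.nullMeasurableSet) (fun s t h => Iic_subset_Iic.2 h)
      ⟨0, measure_ne_top _ _⟩
    rwa [iInter_Iic_eq_empty_iff.2 (by simp), measure_empty] at h
  have htop : Tendsto (fun t => ν (Iic t)) atTop (𝓝 (ν univ)) := tendsto_measure_Iic_atTop ν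
  obtain ⟨t₁, h₁⟩ := (hbot.eventually_lt_const (pos_iff_ne_zero.2 hw0)).exists
  obtain ⟨t₂, h₂⟩ := (htop.eventually_const_lt (by simpa [ν] using hlt)).exists
  obtain ⟨t, ht⟩ := mem_range_of_exists_le_of_exists_ge (continuous_measureReal_Iic ν)
    (c := w.toReal) ⟨t₁, ENNReal.toReal_mono hw' h₁.le⟩
    ⟨t₂, ENNReal.toReal_mono (measure_ne_top _ _) h₂.le⟩
  refine ⟨Iic t ∩ S, inter_subset_right, measurableSet_Iic.inter hS, ?_⟩
  rw [← Measure.restrict_apply measurableSet_Iic,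
    ← ENNReal.toReal_eq_toReal_iff' (measure_ne_top _ _) hw']
  exact ht

/-- The pieces are the successive differences of an increasing chain of sets whose measures are the
partial sums of `w`. -/
theorem exists_disjoint_nat_measure_eq {S : Set ℝ} (hS : MeasurableSet S) {w : ℕ → ℝ≥0∞}
    (hw : ∑' i, w i ≤ μ S) :
    ∃ E : ℕ → Set ℝ, (∀ i, MeasurableSet (E i)) ∧ (∀ i, E i ⊆ S) ∧
      Pairwise (Function.onFun Disjoint E) ∧ ∀ i, μ (E i) = w i := by
  -- The measure of the next set is promised only conditionally, so that `next` is total and the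
  -- recursion can be formed before the measures are known.
  have key : ∀ (n : ℕ) (G : {G : Set ℝ // MeasurableSet G ∧ G ⊆ S}),
      ∃ G' : {G : Set ℝ // MeasurableSet G ∧ G ⊆ S}, G.1 ⊆ G'.1 ∧
        (μ G.1 = ∑ i ∈ Finset.range n, w i → μ G'.1 = ∑ i ∈ Finset.range (n + 1), w i) := by
    rintro n ⟨G, hG, hGS⟩
    by_cases hn : μ G = ∑ i ∈ Finset.range n, w i
    · have h1 : w n ≤ μ (S \ G) := by
        rw [measure_sdiff hGS hG.nullMeasurableSet (measure_ne_top _ _)]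
        refine ENNReal.le_sub_of_add_le_left (measure_ne_top _ _) ?_
        rw [hn, ← Finset.sum_range_succ]
        exact (ENNReal.sum_le_tsum _).trans hw
      obtain ⟨E, hES, hE, hEw⟩ := exists_subset_measure_eq (hS.diff hG) h1
      refine ⟨⟨G ∪ E, hG.union hE, union_subset hGS (hES.trans sdiff_subset)⟩,
        subset_union_left, fun _ => ?_⟩
      rw [measure_union (disjoint_sdiff_right.mono_right hES) hE, hn, hEw, Finset.sum_range_succ]
    · exact ⟨⟨G, hG, hGS⟩, Subset.rfl, fun h => absurd h hn⟩
  choose next hsub hnext using key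
  let G : ℕ → {G : Set ℝ // MeasurableSet G ∧ G ⊆ S} := fun n =>
    Nat.rec ⟨∅, MeasurableSet.empty, empty_subset _⟩ next n
  have hG : ∀ n, G (n + 1) = next n (G n) := fun n => rfl
  have hmono : Monotone fun n => (G n).1 := monotone_nat_of_le_succ fun n => by
    rw [hG]; exact hsub n (G n)
  have hμ : ∀ n, μ (G n).1 = ∑ i ∈ Finset.range n, w i := by
    intro n
    induction n with
    | zero => simp [G]
    | succ n ih => rw [hG]; exact hnext n _ ih
  refine ⟨fun i => (G (i + 1)).1 \ (G i).1, fun i => (G (i + 1)).2.1.diff (G i).2.1,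
    fun i => sdiff_subset.trans (G (i + 1)).2.2, ?_, fun i => ?_⟩
  · rw [pairwise_disjoint_on]
    intro m n hmn
    exact disjoint_sdiff_right.mono_left (sdiff_subset.trans (hmono hmn))
  · have h : (G i).1 ⊆ (G (i + 1)).1 := hmono (Nat.le_succ i)
    rw [measure_sdiff h (G i).2.1.nullMeasurableSet (measure_ne_top _ _), hμ i, hμ (i + 1), Finset.sum_range_succ]
    refine ENNReal.add_sub_cancel_left ?_
    rw [← hμ]; exact measure_ne_top _ _

variable {ι : Type*} [Countable ι]

theorem exists_disjoint_measure_eq {S : Set ℝ} (hS : MeasurableSet S) {w : ι → ℝ≥0∞}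
    (hw : ∑' i, w i ≤ μ S) :
    ∃ E : ι → Set ℝ, (∀ i, MeasurableSet (E i)) ∧ (∀ i, E i ⊆ S) ∧
      Pairwise (Function.onFun Disjoint E) ∧ ∀ i, μ (E i) = w i := by
  obtain ⟨e, he⟩ := exists_injective_nat ι
  obtain ⟨E, h1, h2, h3, h4⟩ := exists_disjoint_nat_measure_eq (μ := μ) hS
    (w := Function.extend e w 0) (by rwa [tsum_extend_zero he])
  exact ⟨fun i => E (e i), fun i => h1 _, fun i => h2 _, fun i j hij => h3 (he.ne hij),
    fun i => by rw [h4, he.extend_apply]⟩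

theorem exists_partition_measure_eq [Nonempty ι] {S : Set ℝ} (hS : MeasurableSet S)
    {w : ι → ℝ≥0∞} (hw : ∑' i, w i = μ S) :
    ∃ E : ι → Set ℝ, (∀ i, MeasurableSet (E i)) ∧ ⋃ i, E i = S ∧
      Pairwise (Function.onFun Disjoint E) ∧ ∀ i, μ (E i) = w i := by
  classical
  obtain ⟨E, h1, h2, h3, h4⟩ := exists_disjoint_measure_eq hS hw.le
  obtain ⟨i₀⟩ := ‹Nonempty ι›
  have hmeas : MeasurableSet (S \ ⋃ i, E i) := hS.diff (MeasurableSet.iUnion h1)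
  have hnull : μ (S \ ⋃ i, E i) = 0 := by
    rw [measure_sdiff (iUnion_subset h2) (MeasurableSet.iUnion h1).nullMeasurableSet
      (measure_ne_top _ _), measure_iUnion h3 h1]
    simp [h4, hw]
  -- The uncovered part of `S` is null, so one piece can absorb it.
  refine ⟨fun i => E i ∪ if i = i₀ then S \ ⋃ i, E i else ∅, fun i => ?_, ?_, ?_, fun i => ?_⟩
  · dsimp only
    split_ifs
    · exact (h1 i).union hmeas
    · simpa using h1 i
  · refine Subset.antisymm (iUnion_subset fun i => union_subset (h2 i) ?_) fun t ht => ?_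
    · split_ifs <;> simp
    · by_cases hE : t ∈ ⋃ i, E i
      · obtain ⟨i, hi⟩ := mem_iUnion.1 hE
        exact mem_iUnion.2 ⟨i, Or.inl hi⟩
      · exact mem_iUnion.2 ⟨i₀, Or.inr (by simpa using ⟨ht, by simpa using hE⟩)⟩
  · intro i j hij
    have hd : ∀ i, Disjoint (E i) (S \ ⋃ i, E i) := fun i =>
      disjoint_sdiff_right.mono_left (subset_iUnion E i)
    have h3' := h3 hij
    simp only [Function.onFun] at h3' ⊢
    rcases eq_or_ne i i₀ with rfl | hi
    · rw [if_pos rfl, if_neg hij.symm, union_empty]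
      exact disjoint_union_left.2 ⟨h3', (hd j).symm⟩
    · rw [if_neg hi, union_empty]
      split_ifs
      · exact disjoint_union_right.2 ⟨h3', hd i⟩
      · simpa using h3'
  · dsimp only
    split_ifs
    · refine le_antisymm ((measure_union_le _ _).trans (by rw [hnull, h4, add_zero])) ?_
      rw [← h4 i]; exact measure_mono subset_union_left
    · rw [union_empty, h4]

theorem exists_halves {S : Set ℝ} (hS : MeasurableSet S) :
    ∃ E : Bool → Set ℝ, (∀ j, MeasurableSet (E j)) ∧ ⋃ j, E j = S ∧
      Pairwise (Function.onFun Disjoint E) ∧ ∀ j, μ (E j) = μ S / 2 :=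
  exists_partition_measure_eq hS (by rw [tsum_bool]; exact ENNReal.add_halves _)

end Splitting

/-! ### Averaging gauges and geometric level sets. -/

/-- A monotone, superhomogeneous functional on nonnegative functions that does not increase under
averaging over countable measurable partitions. -/
structure IsAveragingGauge (μ : Measure ℝ) (M : (ℝ → ℝ≥0∞) → ℝ≥0∞) : Prop where
  mono : ∀ {f g : ℝ → ℝ≥0∞}, f ≤ᵐ[μ] g → M f ≤ M g
  mul_le : ∀ {c : ℝ≥0∞} (f : ℝ → ℝ≥0∞), c ≠ 0 → c ≠ ∞ → c * M f ≤ M fun t => c * f t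
  average : ∀ {ι : Type} [Countable ι] (C : ι → Set ℝ), (∀ i, MeasurableSet (C i)) →
    Pairwise (Function.onFun Disjoint C) → ⋃ i, C i = univ → ∀ f g : ℝ → ℝ≥0∞, Measurable f →
    (∀ i, ∀ t ∈ C i, g t * μ (C i) ≤ ∫⁻ s in C i, f s ∂μ) → M g ≤ M f

/-- Removes the factor `r > 1` that is lost when a function is replaced by a step function on its
level cells. -/
theorem ennreal_le_of_forall_one_lt_mul {a b : ℝ≥0∞}
    (h : ∀ r : ℝ≥0∞, 1 < r → r ≠ ∞ → a ≤ r * b) : a ≤ b := by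
  have h1 : Tendsto (fun r : ℝ≥0∞ => r * b) (𝓝[>] 1) (𝓝 (1 * b)) :=
    (ENNReal.Tendsto.mul_const tendsto_id (Or.inl one_ne_zero)).mono_left nhdsWithin_le_nhds
  rw [one_mul] at h1
  have : (𝓝[>] (1 : ℝ≥0∞)).NeBot := nhdsGT_neBot_of_exists_gt ⟨2, by norm_num⟩
  refine ge_of_tendsto h1 ?_
  filter_upwards [self_mem_nhdsWithin,
    nhdsWithin_le_nhds (gt_mem_nhds (ENNReal.one_lt_top))] with r hr hr'
  exact h r hr hr'.ne

/-- The cells `{f = 0}`, `{f = ∞}` and `{r ^ n ≤ f < r ^ (n + 1)}`, `n ∈ ℤ`. -/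
def levelCell (f : ℝ → ℝ≥0∞) (r : ℝ≥0∞) : Bool ⊕ ℤ → Set ℝ
  | .inl false => f ⁻¹' {0}
  | .inl true => f ⁻¹' {∞}
  | .inr n => f ⁻¹' Ico (r ^ n) (r ^ (n + 1))

section LevelCell

variable {f : ℝ → ℝ≥0∞} {r : ℝ≥0∞}

theorem measurableSet_levelCell (hf : Measurable f) (i : Bool ⊕ ℤ) :
    MeasurableSet (levelCell f r i) := by
  rcases i with (_ | _) | n
  · exact hf (measurableSet_singleton _)
  · exact hf (measurableSet_singleton _)
  · exact hf measurableSet_Ico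

theorem iUnion_levelCell (hr : 1 < r) (hr' : r ≠ ∞) : ⋃ i, levelCell f r i = univ := by
  refine eq_univ_of_forall fun t => mem_iUnion.2 ?_
  by_cases h0 : f t = 0
  · exact ⟨.inl false, h0⟩
  by_cases h1 : f t = ∞
  · exact ⟨.inl true, h1⟩
  obtain ⟨n, hn⟩ := ENNReal.exists_mem_Ico_zpow h0 h1 hr hr'
  exact ⟨.inr n, hn⟩

theorem pairwise_disjoint_levelCell (hr : 1 < r) (hr' : r ≠ ∞) :
    Pairwise (Function.onFun Disjoint (levelCell f r)) := by
  have hr0 : r ≠ 0 := (zero_lt_one.trans hr).ne'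
  have hpos : ∀ n : ℤ, 0 < r ^ n := fun n => ENNReal.zpow_pos hr0 hr' n
  have hmono : Monotone fun n : ℤ => r ^ n := fun m n h => ENNReal.zpow_le_of_le hr.le h
  have hlt : ∀ m n : ℤ, m < n → Disjoint (Ico (r ^ m) (r ^ (m + 1))) (Ico (r ^ n) (r ^ (n + 1))) := by
    intro m n hmn
    rw [Set.disjoint_left]
    intro x hx hx'
    exact (hx.2.trans_le (hmono (Int.add_one_le_of_lt hmn))).not_ge hx'.1
  intro i j hij
  rw [Function.onFun, Set.disjoint_left]
  intro t hi hj
  rcases i with (_ | _) | m <;> rcases j with (_ | _) | n <;>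
    simp only [levelCell, mem_preimage, mem_singleton_iff] at hi hj
  · exact hij rfl
  · simp [hi] at hj
  · exact (hpos n).not_ge (hi ▸ hj.1)
  · simp [hi] at hj
  · exact hij rfl
  · exact not_top_lt (hi ▸ hj.2)
  · exact (hpos m).not_ge (hj ▸ hi.1)
  · exact not_top_lt (hj ▸ hi.2)
  · rcases lt_trichotomy m n with h | h | h
    · exact Set.disjoint_left.1 (hlt m n h) hi hj
    · exact hij (by rw [h])
    · exact Set.disjoint_left.1 (hlt n m h) hj hi

/-- On each level cell the function is comparable to a constant. -/
theorem exists_level (hr : 1 < r) (hr' : r ≠ ∞) (f : ℝ → ℝ≥0∞) (i : Bool ⊕ ℤ) :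
    ∃ c : ℝ≥0∞, ∀ t ∈ levelCell f r i, f t ≤ c ∧ c ≤ r * f t := by
  have hr0 : r ≠ 0 := (zero_lt_one.trans hr).ne'
  rcases i with (_ | _) | n
  · exact ⟨0, fun t (ht : f t = 0) => by simp [ht]⟩
  · exact ⟨∞, fun t (ht : f t = ∞) => by simp [ht, hr0]⟩
  · refine ⟨r ^ (n + 1), fun t ht => ⟨ht.2.le, ?_⟩⟩
    rw [ENNReal.zpow_add hr0 hr', zpow_one, mul_comm]
    exact mul_le_mul_right ht.1 r

end LevelCell

variable {μ : Measure ℝ} {M : (ℝ → ℝ≥0∞) → ℝ≥0∞}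

namespace IsAveragingGauge

theorem mono_of_le (hM : IsAveragingGauge μ M) {f g : ℝ → ℝ≥0∞} (h : ∀ t, f t ≤ g t) :
    M f ≤ M g :=
  hM.mono (ae_of_all _ h)

/-- Averaging over countably many disjoint cells that need not cover the line. -/
theorem average_le (hM : IsAveragingGauge μ M) {ι : Type} [Countable ι] (C : ι → Set ℝ)
    (hC : ∀ i, MeasurableSet (C i)) (hd : Pairwise (Function.onFun Disjoint C))
    {f g : ℝ → ℝ≥0∞} (hf : Measurable f)
    (hg : ∀ i, ∀ t ∈ C i, g t * μ (C i) ≤ ∫⁻ s in C i, f s ∂μ)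
    (hoff : ∀ t ∉ ⋃ i, C i, g t ≤ f t) : M g ≤ M f := by
  refine ennreal_le_of_forall_one_lt_mul fun r hr hr' => ?_
  have hr0 : r ≠ 0 := (zero_lt_one.trans hr).ne'
  have hU : MeasurableSet (⋃ i, C i) := MeasurableSet.iUnion hC
  -- Off the given cells the line is cut into level sets of `f`, where averaging changes `f` by at
  -- most the factor `r`.
  let D : ι ⊕ (Bool ⊕ ℤ) → Set ℝ := Sum.elim C fun j => levelCell f r j \ ⋃ i, C i
  have key : M (fun t => r⁻¹ * g t) ≤ M f := by
    refine hM.average D ?_ ?_ ?_ f _ hf ?_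
    · rintro (i | j)
      · exact hC i
      · exact (measurableSet_levelCell hf j).diff hU
    · rintro (i | i) (j | j) hij
      · exact hd fun h => hij (by rw [h])
      · exact disjoint_sdiff_right.mono_left (subset_iUnion C i)
      · exact (disjoint_sdiff_right.mono_left (subset_iUnion C j)).symm
      · exact (pairwise_disjoint_levelCell hr hr' fun h => hij (by rw [h])).mono
          sdiff_subset sdiff_subset
    · refine eq_univ_of_forall fun t => mem_iUnion.2 ?_
      by_cases ht : t ∈ ⋃ i, C i
      · obtain ⟨i, hi⟩ := mem_iUnion.1 ht
        exact ⟨.inl i, hi⟩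
      · obtain ⟨j, hj⟩ := mem_iUnion.1 ((iUnion_levelCell (f := f) hr hr').symm ▸ mem_univ t)
        exact ⟨.inr j, hj, ht⟩
    · rintro (i | j) t ht
      · refine le_trans ?_ (hg i t ht)
        rw [mul_assoc]
        exact mul_le_of_le_one_left' (ENNReal.inv_le_one.2 hr.le)
      · obtain ⟨c, hc⟩ := exists_level hr hr' f j
        calc r⁻¹ * g t * μ (D (.inr j)) ≤ ∫⁻ _ in D (.inr j), r⁻¹ * c ∂μ := by
              rw [setLIntegral_const]
              gcongr
              exact (hoff t ht.2).trans (hc t ht.1).1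
          _ ≤ ∫⁻ s in D (.inr j), f s ∂μ := by
              refine setLIntegral_mono hf fun s hs => ?_
              rw [← ENNReal.div_eq_inv_mul]
              exact ENNReal.div_le_of_le_mul' (hc s hs.1).2
  have h2 := hM.mul_le g (ENNReal.inv_ne_zero.2 hr') (ENNReal.inv_ne_top.2 hr0)
  have h3 := mul_le_mul_right (h2.trans key) r
  rwa [← mul_assoc, ENNReal.mul_inv_cancel hr0 hr', one_mul] at h3

end IsAveragingGauge

/-! ### Step functions on disjoint cells. -/

open Classical in
/-- The function with the value `v k` on the cell `D k` that agrees with `f` off the cells. -/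
noncomputable def paste {κ : Type} (D : κ → Set ℝ) (v : κ → ℝ≥0∞) (f : ℝ → ℝ≥0∞) (t : ℝ) : ℝ≥0∞ :=
  if h : ∃ k, t ∈ D k then v h.choose else f t

section Paste

variable {κ : Type} {D : κ → Set ℝ} {v : κ → ℝ≥0∞} {f : ℝ → ℝ≥0∞} {t : ℝ}

theorem paste_of_mem (hd : Pairwise (Function.onFun Disjoint D)) {k : κ} (ht : t ∈ D k) :
    paste D v f t = v k := by
  have h : ∃ k, t ∈ D k := ⟨k, ht⟩
  rw [paste, dif_pos h]
  congr 1
  by_contra hne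
  exact Set.disjoint_left.1 (hd hne) h.choose_spec ht

theorem paste_of_notMem (ht : t ∉ ⋃ k, D k) : paste D v f t = f t := by
  rw [paste, dif_neg (by simpa using ht)]

theorem paste_cases (hd : Pairwise (Function.onFun Disjoint D)) {p : ℝ → ℝ≥0∞ → Prop}
    (h1 : ∀ k, ∀ t ∈ D k, p t (v k)) (h2 : ∀ t ∉ ⋃ k, D k, p t (f t)) (t : ℝ) :
    p t (paste D v f t) := by
  by_cases ht : t ∈ ⋃ k, D k
  · obtain ⟨k, hk⟩ := mem_iUnion.1 ht
    rw [paste_of_mem hd hk]; exact h1 k t hk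
  · rw [paste_of_notMem ht]; exact h2 t ht

theorem measurable_paste [Countable κ] (hD : ∀ k, MeasurableSet (D k))
    (hd : Pairwise (Function.onFun Disjoint D)) (hf : Measurable f) : Measurable (paste D v f) := by
  intro s hs
  have : paste D v f ⁻¹' s = (⋃ k, D k ∩ {_t | v k ∈ s}) ∪ ((⋃ k, D k)ᶜ ∩ f ⁻¹' s) := by
    ext t
    by_cases ht : t ∈ ⋃ k, D k
    · obtain ⟨k, hk⟩ := mem_iUnion.1 ht
      have huniq : ∀ j, t ∈ D j → j = k := fun j hj => by
        by_contra hne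
        exact Set.disjoint_left.1 (hd hne) hj hk
      simp only [mem_preimage, paste_of_mem hd hk, mem_union, mem_iUnion, mem_inter_iff,
        mem_ofPred_eq, mem_compl_iff, ht, not_true, false_and, or_false]
      exact ⟨fun h => ⟨k, hk, h⟩, fun ⟨j, hj, h⟩ => huniq j hj ▸ h⟩
    · have ht' : ∀ k, t ∉ D k := by simpa using ht
      simp [paste_of_notMem ht, ht']
  rw [this]
  exact (MeasurableSet.iUnion fun k => (hD k).inter (MeasurableSet.const _)).union
    ((MeasurableSet.iUnion hD).compl.inter (hf hs))

theorem lintegral_paste_cell (hD : ∀ k, MeasurableSet (D k))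
    (hd : Pairwise (Function.onFun Disjoint D)) (k : κ) :
    ∫⁻ s in D k, paste D v f s ∂μ = v k * μ (D k) := by
  rw [setLIntegral_congr_fun (hD k) fun s hs => paste_of_mem hd hs, setLIntegral_const]

end Paste

/-- Merge the cells of a step function along a map of their indices, and average. -/
theorem IsAveragingGauge.average_paste (hM : IsAveragingGauge μ M) {κ κ' : Type} [Countable κ]
    [Countable κ'] {D : κ → Set ℝ} (hD : ∀ k, MeasurableSet (D k))
    (hd : Pairwise (Function.onFun Disjoint D)) {f : ℝ → ℝ≥0∞} (hf : Measurable f) (π : κ → κ')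
    {v v' : κ → ℝ≥0∞}
    (hv : ∀ k, v' k * ∑' l : {l // π l = π k}, μ (D l) ≤
      ∑' l : {l // π l = π k}, v l * μ (D l)) :
    M (paste D v' f) ≤ M (paste D v f) := by
  have hU : ∀ j, MeasurableSet (⋃ l : {l // π l = j}, D l) := fun j =>
    MeasurableSet.iUnion fun l => hD _
  have hsub : ∀ j, Pairwise (Function.onFun Disjoint fun l : {l // π l = j} => D l) :=
    fun j l l' hl => hd fun h => hl (Subtype.ext h)
  refine hM.average_le (fun j => ⋃ l : {l // π l = j}, D l) hU ?_ (measurable_paste hD hd hf) ?_ ?_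
  · intro i j hij
    refine disjoint_iUnion_left.2 fun l => disjoint_iUnion_right.2 fun l' => hd fun h => hij ?_
    rw [← l.2, ← l'.2, h]
  · intro j t ht
    obtain ⟨⟨k, rfl⟩, hk⟩ := mem_iUnion.1 ht
    rw [paste_of_mem hd hk, measure_iUnion (hsub _) fun l => hD _,
      lintegral_iUnion (fun l => hD _) (hsub _)]
    simp only [lintegral_paste_cell hD hd]
    exact hv k
  · intro t ht
    have ht' : t ∉ ⋃ k, D k := fun h => ht <| by
      obtain ⟨k, hk⟩ := mem_iUnion.1 h
      exact mem_iUnion.2 ⟨π k, mem_iUnion.2 ⟨⟨k, rfl⟩, hk⟩⟩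
    rw [paste_of_notMem ht', paste_of_notMem ht']

theorem ennreal_le_of_tendsto_one {q : ℕ → ℝ≥0∞} (hq : Tendsto q atTop (𝓝 1)) {a b : ℝ≥0∞}
    (h : ∀ n, q n * a ≤ b) : a ≤ b := by
  have h1 : Tendsto (fun n => q n * a) atTop (𝓝 (1 * a)) :=
    ENNReal.Tendsto.mul_const hq (Or.inl one_ne_zero)
  rw [one_mul] at h1
  exact le_of_tendsto' h1 h

section Paste

variable {κ κ' : Type} {D : κ → Set ℝ} {v : κ → ℝ≥0∞} {f g : ℝ → ℝ≥0∞}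

theorem paste_eq (hd : Pairwise (Function.onFun Disjoint D)) (h1 : ∀ k, ∀ t ∈ D k, g t = v k)
    (h2 : ∀ t ∉ ⋃ k, D k, g t = f t) : paste D v f = g :=
  funext <| paste_cases (p := fun t x => x = g t) hd (fun k t ht => (h1 k t ht).symm)
    fun t ht => (h2 t ht).symm

theorem paste_refine (hd : Pairwise (Function.onFun Disjoint D)) {H : κ → κ' → Set ℝ}
    (hH : ∀ k, Pairwise (Function.onFun Disjoint (H k))) (hU : ∀ k, ⋃ j, H k j = D k) :
    Pairwise (Function.onFun Disjoint fun x : κ × κ' => H x.1 x.2) ∧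
      paste D v f = paste (fun x : κ × κ' => H x.1 x.2) (fun x => v x.1) f := by
  have hsub : ∀ k j, H k j ⊆ D k := fun k j => hU k ▸ subset_iUnion (H k) j
  have hd' : Pairwise (Function.onFun Disjoint fun x : κ × κ' => H x.1 x.2) := by
    rintro ⟨k, j⟩ ⟨k', j'⟩ hne
    by_cases hk : k = k'
    · subst hk
      exact hH k fun h => hne (congrArg (Prod.mk k) h)
    · exact (hd hk).mono (hsub _ _) (hsub _ _)
  have hun : (⋃ x : κ × κ', H x.1 x.2) = ⋃ k, D k := by
    rw [iUnion_prod']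
    simp [hU]
  refine ⟨hd', paste_eq hd (fun k t ht => ?_) fun t ht => paste_of_notMem (by rwa [hun])⟩
  rw [← hU k] at ht
  obtain ⟨j, hj⟩ := mem_iUnion.1 ht
  exact paste_of_mem (D := fun x : κ × κ' => H x.1 x.2) hd' (k := (k, j)) hj

/-- The factor `c` also acts off the cells, where the function is kept; this is where `c ≤ 1`
enters. -/
theorem mul_paste_le {c : ℝ≥0∞} (hc : c ≤ 1) (hd : Pairwise (Function.onFun Disjoint D))
    {w : κ → ℝ≥0∞} (hw : ∀ k, c * w k ≤ v k) (t : ℝ) : c * paste D w f t ≤ paste D v f t := by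
  refine paste_cases (p := fun t x => c * paste D w f t ≤ x) hd (fun k t ht => ?_)
    (fun t ht => ?_) t
  · rw [paste_of_mem hd ht]; exact hw k
  · rw [paste_of_notMem ht]; exact mul_le_of_le_one_left' hc

end Paste

/-! ### Exchanging values by repeated averaging. -/

/-- The functional `M` does not increase when the values of a step function on cells of equal
measure that are paired by an involution are exchanged with the weights `p` and `q`. -/
def Exchanges (μ : Measure ℝ) (M : (ℝ → ℝ≥0∞) → ℝ≥0∞) (p q : ℝ≥0∞) : Prop :=
  ∀ (κ : Type) [Countable κ] (D : κ → Set ℝ), (∀ k, MeasurableSet (D k)) →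
    Pairwise (Function.onFun Disjoint D) → ∀ σ : κ → κ, Function.Involutive σ →
    (∀ k, μ (D (σ k)) = μ (D k)) → ∀ (v : κ → ℝ≥0∞) (f : ℝ → ℝ≥0∞), Measurable f →
    M (paste D (fun k => p * v k + q * v (σ k)) f) ≤ M (paste D v f)

/-- Average over the orbits of `σ`, which are the fibres of `k ↦ {k, σ k}`. At a fixed point the two
weights add up to 1. -/
theorem exchanges_half (hM : IsAveragingGauge μ M) : Exchanges μ M 2⁻¹ 2⁻¹ := by
  classical
  intro κ _ D hD hd σ hσ hμ v f hf
  refine hM.average_paste hD hd hf (fun k => ({k, σ k} : Finset κ)) fun k => ?_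
  have hfib : {l | ({l, σ l} : Finset κ) = {k, σ k}} = (({k, σ k} : Finset κ) : Set κ) := by
    ext l
    simp only [mem_ofPred_eq, Finset.coe_insert, Finset.coe_singleton, mem_insert_iff,
      mem_singleton_iff]
    constructor
    · intro h
      have : l ∈ ({k, σ k} : Finset κ) := h ▸ Finset.mem_insert_self l _
      simpa using this
    · rintro (rfl | rfl)
      · rfl
      · rw [hσ k, Finset.pair_comm]
  have hsum : ∀ F : κ → ℝ≥0∞, ∑' l : {l // ({l, σ l} : Finset κ) = {k, σ k}}, F l =
      ∑ l ∈ ({k, σ k} : Finset κ), F l := fun F =>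
    (tsum_congr_set_coe F hfib).trans (Finset.tsum_subtype _ F)
  rw [hsum fun l => μ (D l), hsum fun l => v l * μ (D l)]
  by_cases hk : σ k = k
  · simp only [hk, Finset.pair_eq_singleton, Finset.sum_singleton]
    rw [← add_mul, ENNReal.inv_two_add_inv_two, one_mul]
  · rw [Finset.sum_pair (Ne.symm hk), Finset.sum_pair (Ne.symm hk), hμ, ← two_mul, ← mul_assoc,
      ← mul_add, mul_comm (2⁻¹ : ℝ≥0∞), mul_assoc (v k + v (σ k)),
      ENNReal.inv_mul_cancel two_ne_zero ENNReal.ofNat_ne_top, mul_one, add_mul]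

/-- The counterflow step: exchanging halves of the cells three times improves the weights. -/
theorem Exchanges.counterflow [IsFiniteMeasure μ] [NullSingletonClass μ]
    (hM : IsAveragingGauge μ M) {p q : ℝ≥0} (hpq : p + q = 1) (h : Exchanges μ M p q) :
    Exchanges μ M (p ^ 2 + p * q ^ 2 : ℝ≥0) (q + p ^ 2 * q : ℝ≥0) := by
  intro κ _ D hD hd σ hσ hμ v f hf
  choose H hHm hHU hHd hHμ using fun k => exists_halves (μ := μ) (hD k)
  have hd' := (paste_refine (v := v) (f := f) hd hHd hHU).1
  have href : ∀ v : κ → ℝ≥0∞, paste D v f = paste (fun x : κ × Bool => H x.1 x.2) (fun x => v x.1) f :=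
    fun v => (paste_refine hd hHd hHU).2
  set D' : κ × Bool → Set ℝ := fun x => H x.1 x.2
  have hD' : ∀ x, MeasurableSet (D' x) := fun x => hHm _ _
  have hpq' : (p : ℝ≥0∞) + q = 1 := by exact_mod_cast hpq
  have hfix : ∀ a : ℝ≥0∞, p * a + q * a = a := fun a => by rw [← add_mul, hpq', one_mul]
  have hlev : ∀ (j₀ : Bool) (v : κ × Bool → ℝ≥0∞),
      M (paste D' (fun x => if x.2 = j₀ then p * v x + q * v (σ x.1, x.2) else v x) f) ≤
        M (paste D' v f) := by
    intro j₀ v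
    -- The involution is the identity off the level `j₀`, where `p + q = 1` keeps the values.
    have := h (κ × Bool) D' hD' hd' (fun x => if x.2 = j₀ then (σ x.1, x.2) else x)
      (fun x => by
        dsimp only
        by_cases hx : x.2 = j₀
        · simp [hx, hσ x.1]; rw [← hx]
        · simp [hx])
      (fun x => by
        by_cases hx : x.2 = j₀
        · simp [D', hx, hHμ, hμ]
        · simp [hx]) v f hf
    refine le_of_eq_of_le (congrArg M (congrArg (paste D' · f) (funext fun x => ?_))) this
    by_cases hx : x.2 = j₀
    · simp [hx]
    · simp [hx, hfix]
  have hflip : ∀ v : κ × Bool → ℝ≥0∞,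
      M (paste D' (fun x => p * v x + q * v (σ x.1, !x.2)) f) ≤ M (paste D' v f) := fun v =>
    h (κ × Bool) D' hD' hd' (fun x => (σ x.1, !x.2)) (fun x => by simp [hσ x.1])
      (fun x => by simp [D', hHμ, hμ]) v f hf
  rw [href v]
  -- The order of the meetings: false halves with each other, every half with the opposite half of
  -- the partner, true halves with each other. The own weight becomes `p²` on the false half and `p²
  -- + 2pq²` on the true half, with mean `p² + pq²`.
  let u₁ : κ × Bool → ℝ≥0∞ := fun x => if x.2 = false then p * v x.1 + q * v (σ x.1) else v x.1
  let u₂ : κ × Bool → ℝ≥0∞ := fun x => p * u₁ x + q * u₁ (σ x.1, !x.2)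
  let u₃ : κ × Bool → ℝ≥0∞ := fun x =>
    if x.2 = true then p * u₂ x + q * u₂ (σ x.1, x.2) else u₂ x
  refine le_trans (b := M (paste D' u₃ f)) ?_
    ((hlev true u₂).trans ((hflip u₁).trans (hlev false fun x => v x.1)))
  rw [href]
  refine hM.average_paste hD' hd' hf Prod.fst fun x => ?_
  obtain ⟨k, j⟩ := x
  have hsum : ∀ F : κ × Bool → ℝ≥0∞,
      ∑' l : {l : κ × Bool // l.1 = k}, F l = F (k, false) + F (k, true) := by
    intro F
    let e : Bool ≃ {l : κ × Bool // l.1 = k} :=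
      { toFun := fun j => ⟨(k, j), rfl⟩
        invFun := fun l => l.1.2
        left_inv := fun j => rfl
        right_inv := by rintro ⟨⟨k', j⟩, rfl⟩; rfl }
    rw [← e.tsum_eq, tsum_bool]
    rfl
  rw [hsum fun l => μ (D' l), hsum fun l => u₃ l * μ (D' l)]
  simp only [D', u₃, u₂, u₁, hHμ, hσ k, Bool.not_false, Bool.not_true, if_true, if_false,
    Bool.false_eq_true, Bool.true_eq_false]
  rw [← two_mul, ← mul_assoc, ← add_mul]
  refine le_of_eq (congrArg (· * (μ (D k) / 2)) ?_)
  have ha : ((p ^ 2 + p * q ^ 2 : ℝ≥0) : ℝ≥0∞) * 2 = 2 * p ^ 2 + 2 * p * q ^ 2 := by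
    push_cast; ring
  have hb : ((q + p ^ 2 * q : ℝ≥0) : ℝ≥0∞) * 2 = q + 2 * p * q + p ^ 2 * q + q ^ 3 := by
    have : (q + p ^ 2 * q) * 2 = q + 2 * p * q + p ^ 2 * q + q ^ 3 := by
      have hq : (p : ℝ) = 1 - q := by
        rw [eq_sub_iff_add_eq]; exact_mod_cast hpq
      refine NNReal.eq ?_
      push_cast
      rw [hq]
      ring
    exact_mod_cast this
  calc _ = (((p ^ 2 + p * q ^ 2 : ℝ≥0) : ℝ≥0∞) * 2) * v k +
        (((q + p ^ 2 * q : ℝ≥0) : ℝ≥0∞) * 2) * v (σ k) := by ring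
    _ = _ := by rw [ha, hb]; ring

/-- Iterate the counterflow step from `p = 1/2`. For `p ≤ 1/2` the new weight `p - p² + p³` is at
most `p (1 - p/2)`, a recursion whose solutions decay like `2/n`. -/
theorem exists_exchanges [IsFiniteMeasure μ] [NullSingletonClass μ] (hM : IsAveragingGauge μ M)
    (n : ℕ) : ∃ p q : ℝ≥0, p + q = 1 ∧ (p : ℝ) ≤ 2 / (n + 4) ∧ Exchanges μ M p q := by
  induction n with
  | zero =>
    refine ⟨2⁻¹, 2⁻¹, by rw [← two_mul]; norm_num, by norm_num, ?_⟩
    simpa using exchanges_half hM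
  | succ n ih =>
    obtain ⟨p, q, hpq, hp, h⟩ := ih
    have hq : (q : ℝ) = 1 - p := by
      rw [eq_sub_iff_add_eq, add_comm]; exact_mod_cast hpq
    refine ⟨_, _, ?_, ?_, h.counterflow hM hpq⟩
    · refine NNReal.eq ?_
      push_cast
      rw [hq]
      ring
    · have hn : (0 : ℝ) ≤ n := n.cast_nonneg
      have h4 : (2 : ℝ) / (n + 4) ≤ 1 / 2 := by
        rw [div_le_div_iff₀ (by positivity) (by norm_num)]; linarith
      have hp0 : (0 : ℝ) ≤ p := p.2
      push_cast
      rw [hq]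
      calc (p : ℝ) ^ 2 + p * (1 - p) ^ 2 ≤ p * (1 - p / 2) := by
            nlinarith [mul_nonneg hp0 (mul_nonneg hp0 (show (0 : ℝ) ≤ 1 / 2 - p by linarith))]
        -- The function `x ↦ x (1 - x/2)` increases on `[0, 1]`.
        _ ≤ 2 / (n + 4) * (1 - 2 / (n + 4) / 2) := by nlinarith
        _ ≤ 2 / (n + 1 + 4) := by
            rw [show (2 : ℝ) / (n + 4) * (1 - 2 / (n + 4) / 2) = 2 * (n + 3) / (n + 4) ^ 2 by
              field_simp; ring, div_le_div_iff₀ (by positivity) (by positivity)]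
            nlinarith

/-- Exchanging the values of a step function on cells of equal measure. -/
theorem IsAveragingGauge.exchange [IsFiniteMeasure μ] [NullSingletonClass μ]
    (hM : IsAveragingGauge μ M) {κ : Type} [Countable κ] {D : κ → Set ℝ}
    (hD : ∀ k, MeasurableSet (D k)) (hd : Pairwise (Function.onFun Disjoint D)) {σ : κ → κ}
    (hσ : Function.Involutive σ) (hμ : ∀ k, μ (D (σ k)) = μ (D k)) (v : κ → ℝ≥0∞)
    {f : ℝ → ℝ≥0∞} (hf : Measurable f) :
    M (paste D (fun k => v (σ k)) f) ≤ M (paste D v f) := by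
  choose p q hpq hp h using exists_exchanges hM (μ := μ)
  have hq : ∀ n, (q n : ℝ) = 1 - p n := fun n => by
    rw [eq_sub_iff_add_eq, add_comm]; exact_mod_cast hpq n
  have hp0 : Tendsto (fun n => (p n : ℝ)) atTop (𝓝 0) := by
    refine squeeze_zero (fun n => (p n).2) hp ?_
    exact Tendsto.div_atTop tendsto_const_nhds
      (tendsto_atTop_add_const_right _ _ tendsto_natCast_atTop_atTop)
  have hq1 : Tendsto (fun n => (q n : ℝ≥0∞)) atTop (𝓝 1) := by
    rw [← ENNReal.coe_one, ENNReal.tendsto_coe, ← NNReal.tendsto_coe]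
    simp only [hq]
    simpa using hp0.const_sub 1
  refine ennreal_le_of_tendsto_one hq1 fun n => ?_
  have hq0 : (q n : ℝ≥0∞) ≤ 1 := by
    exact_mod_cast (hpq n) ▸ (le_add_self : q n ≤ p n + q n)
  rcases eq_or_ne (q n : ℝ≥0∞) 0 with h0 | h0
  · simp [h0]
  -- Dropping the nonnegative term `p v k` costs only the factor `q n`, which tends to 1.
  · refine (hM.mul_le _ h0 ENNReal.coe_ne_top).trans ?_
    refine le_trans (hM.mono_of_le ?_) (h n κ D hD hd σ hσ hμ v f hf)
    exact mul_paste_le hq0 hd fun k => le_add_self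

/-! ### Rearrangement and transport of step functions. -/

theorem measure_eq_tsum_inter {ι : Type} [Countable ι] {S : Set ℝ} {B : ι → Set ℝ}
    (hS : MeasurableSet S) (hB : ∀ i, MeasurableSet (B i))
    (hd : Pairwise (Function.onFun Disjoint B)) (hsub : S ⊆ ⋃ i, B i) :
    μ S = ∑' i, μ (S ∩ B i) := by
  rw [← measure_iUnion (fun i j hij => (hd hij).mono inter_subset_right inter_subset_right)
    fun i => hS.inter (hB i), ← inter_iUnion, inter_eq_left.2 hsub]

section Rearrange

variable [IsFiniteMeasure μ] [NullSingletonClass μ]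

/-- As `A i` may meet every `B q`, one exchange is arranged to put the right value on half of each
`B i`. The other halves pose the same problem and get `c * a i` by induction; averaging over `B i`
then gives `(1 + c) / 2`. The constant precedes the families because the induction hypothesis is
applied to other families and another background function. -/
theorem IsAveragingGauge.exists_rearrange_mul (hM : IsAveragingGauge μ M) {ι : Type} [Countable ι]
    [Nonempty ι] (n : ℕ) : ∃ c : ℝ≥0, c + 2⁻¹ ^ n = 1 ∧ ∀ A B : ι → Set ℝ,
      (∀ i, MeasurableSet (A i)) → Pairwise (Function.onFun Disjoint A) →
      (∀ i, MeasurableSet (B i)) → Pairwise (Function.onFun Disjoint B) →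
      ⋃ i, A i = ⋃ i, B i → (∀ i, μ (A i) = μ (B i)) → ∀ (a : ι → ℝ≥0∞) (f : ℝ → ℝ≥0∞),
      Measurable f → M (paste B (fun i => c * a i) f) ≤ M (paste A a f) := by
  induction n with
  | zero =>
    refine ⟨0, by simp, fun A B hA hAd hB hBd hU hμ a f hf => hM.mono_of_le ?_⟩
    refine paste_cases (p := fun t x => x ≤ paste A a f t) hBd (by simp) fun t ht => ?_
    rw [paste_of_notMem (hU ▸ ht)]
  | succ n ih =>
    obtain ⟨c, hc, ih⟩ := ih
    refine ⟨(1 + c) / 2, ?_, fun A B hA hAd hB hBd hU hμ a f hf => ?_⟩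
    · rw [pow_succ]
      refine NNReal.eq ?_
      push_cast
      have : (c : ℝ) + 2⁻¹ ^ n = 1 := by
        simpa using congrArg NNReal.toReal hc
      linear_combination (1 / 2 : ℝ) * this
    have hABm : ∀ x : ι × ι, MeasurableSet (A x.1 ∩ B x.2) := fun x => (hA _).inter (hB _)
    choose H hHm hHU hHd hHμ using fun x => exists_halves (μ := μ) (hABm x)
    have hABd : Pairwise (Function.onFun Disjoint fun x : ι × ι => A x.1 ∩ B x.2) := by
      rintro ⟨p, q⟩ ⟨p', q'⟩ hne
      by_cases hp : p = p'
      · subst hp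
        exact (hBd fun h => hne (congrArg (Prod.mk p) h)).mono inter_subset_right inter_subset_right
      · exact (hAd hp).mono inter_subset_left inter_subset_left
    have hHd' : Pairwise (Function.onFun Disjoint fun y : (ι × ι) × Bool => H y.1 y.2) :=
      (paste_refine (v := fun _ => 0) (f := f) hABd hHd hHU).1
    have hH : ∀ x x' j j', (x, j) ≠ (x', j') → Disjoint (H x j) (H x' j') :=
      fun x x' j j' h => hHd' (i := (x, j)) (j := (x', j')) h
    have hHsub : ∀ x j, H x j ⊆ A x.1 ∩ B x.2 := fun x j => hHU x ▸ subset_iUnion (H x) j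
    have hμA : ∀ i, ∑' q, μ (A i ∩ B q) = μ (B i) := fun i => by
      rw [← hμ, ← measure_eq_tsum_inter (hA i) hB hBd (hU ▸ subset_iUnion A i)]
    have hμB : ∀ i, ∑' q, μ (A q ∩ B i) = μ (B i) := fun i => by
      rw [measure_eq_tsum_inter (hB i) hA hAd (hU ▸ subset_iUnion B i)]
      simp only [inter_comm (B i)]
    have hhalf : ∀ F : ι → ℝ≥0∞, ∑' q, F q / 2 = (∑' q, F q) / 2 := fun F => by
      simp only [div_eq_mul_inv, ENNReal.tsum_mul_right]
    -- the columns of the two families of halves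
    have hcol : ∀ j i, μ (⋃ p, H (p, i) j) = μ (B i) / 2 := fun j i => by
      rw [measure_iUnion (fun p p' hp => hH _ _ _ _ (by simpa using hp)) fun p => hHm _ _]
      simp only [hHμ, hhalf, hμB]
    have hcolm : ∀ j i, MeasurableSet (⋃ p, H (p, i) j) := fun j i =>
      MeasurableSet.iUnion fun p => hHm _ _
    have hcold : ∀ j, Pairwise (Function.onFun Disjoint fun i => ⋃ p, H (p, i) j) :=
      fun j i i' hi => disjoint_iUnion_left.2 fun p => disjoint_iUnion_right.2 fun p' =>
        hH _ _ _ _ fun h => hi (by simpa using (congrArg (fun y => y.1.2) h))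
    have hcolB : ∀ j i, (⋃ p, H (p, i) j) ⊆ B i := fun j i =>
      iUnion_subset fun p => (hHsub _ _).trans inter_subset_right
    have hrowm : ∀ i, MeasurableSet (⋃ q, H (i, q) false) := fun i =>
      MeasurableSet.iUnion fun q => hHm _ _
    -- The false halves inside `A i` are recut into `E i q`, to be exchanged with `H (q, i) true ⊆ A
    -- q ∩ B i`. The totals agree since `μ (A i) = μ (B i)`.
    choose E hEm hEU hEd hEμ using fun i => exists_partition_measure_eq (μ := μ) (hrowm i)
      (w := fun q => μ (H (q, i) true)) (by
        rw [measure_iUnion (fun p p' hp => hH _ _ _ _ (by simpa using hp)) fun p => hHm _ _]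
        simp only [hHμ, hhalf, hμA, hμB])
    have hEsub : ∀ i q, E i q ⊆ ⋃ q, H (i, q) false := fun i q => hEU i ▸ subset_iUnion (E i) q
    have hEA : ∀ i q, E i q ⊆ A i := fun i q => (hEsub i q).trans
      (iUnion_subset fun q => (hHsub _ _).trans inter_subset_left)
    have hEH : ∀ i q x, Disjoint (E i q) (H x true) := fun i q x =>
      (disjoint_iUnion_left.2 fun q => hH _ _ _ _ (by simp)).mono_left (hEsub i q)
    have hEE : ∀ x x' : ι × ι, x ≠ x' → Disjoint (E x.1 x.2) (E x'.1 x'.2) := by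
      rintro ⟨p, q⟩ ⟨p', q'⟩ hne
      by_cases hp : p = p'
      · subst hp
        exact hEd p fun h => hne (congrArg (Prod.mk p) h)
      · exact (hAd hp).mono (hEA _ _) (hEA _ _)
    let D : (ι × ι) × Bool → Set ℝ := fun y =>
      if y.2 then H (y.1.2, y.1.1) true else E y.1.1 y.1.2
    have hDm : ∀ y, MeasurableSet (D y) := by
      rintro ⟨x, _ | _⟩
      exacts [hEm _ _, hHm _ _]
    have hDd : Pairwise (Function.onFun Disjoint D) := by
      rintro ⟨x, _ | _⟩ ⟨x', _ | _⟩ hne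
      · exact hEE x x' fun h => hne (by rw [h])
      · exact hEH _ _ _
      · exact (hEH _ _ _).symm
      · refine hH _ _ _ _ fun h => hne ?_
        simp only [Prod.mk.injEq, and_true] at h ⊢
        exact Prod.ext h.2 h.1
    -- Each piece carries the value of the `A`-cell containing it. After the exchange `H (q, i) true
    -- ⊆ B i` carries `a i`, as wanted, and `E i q` carries `a q`.
    let v : (ι × ι) × Bool → ℝ≥0∞ := fun y => if y.2 then a y.1.2 else a y.1.1
    have h1 : M (paste D v f) ≤ M (paste A a f) := by
      refine hM.mono_of_le (paste_cases (p := fun t x => x ≤ paste A a f t) hDd ?_ ?_)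
      · rintro ⟨x, _ | _⟩ t ht
        · rw [paste_of_mem hAd (hEA _ _ ht)]; rfl
        · rw [paste_of_mem hAd (hHsub _ _ ht).1]; rfl
      · intro t ht
        rw [paste_of_notMem]
        refine fun hA' => ht ?_
        obtain ⟨i, hi⟩ := mem_iUnion.1 hA'
        obtain ⟨q, hq⟩ := mem_iUnion.1 (hU ▸ hA')
        have : t ∈ ⋃ j, H (i, q) j := by rw [hHU]; exact ⟨hi, hq⟩
        obtain ⟨_ | _, hj⟩ := mem_iUnion.1 this
        · have : t ∈ ⋃ q, E i q := by rw [hEU]; exact mem_iUnion.2 ⟨q, hj⟩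
          obtain ⟨q', hq'⟩ := mem_iUnion.1 this
          exact mem_iUnion.2 ⟨((i, q'), false), hq'⟩
        · exact mem_iUnion.2 ⟨((q, i), true), hj⟩
    have h2 := hM.exchange hDm hDd (σ := fun y => (y.1, !y.2)) (fun y => by simp)
      (by rintro ⟨x, _ | _⟩ <;> simp [D, hEμ]) v hf
    -- The true halves are finished and join the background for the induction on the false halves.
    let f₁ : ℝ → ℝ≥0∞ := paste (fun i => ⋃ p, H (p, i) true) a f
    have hf₁ : Measurable f₁ := measurable_paste (hcolm true) (hcold true) hf
    have hA'd : Pairwise (Function.onFun Disjoint fun q => ⋃ p, E p q) := fun q q' hq =>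
      disjoint_iUnion_left.2 fun p => disjoint_iUnion_right.2 fun p' =>
        hEE (p, q) (p', q') fun h => hq (congrArg Prod.snd h)
    have h3 : M (paste (fun q => ⋃ p, E p q) a f₁) ≤ M (paste D (fun y => v (y.1, !y.2)) f) := by
      refine hM.mono_of_le (paste_cases
        (p := fun t x => x ≤ paste D (fun y => v (y.1, !y.2)) f t) hA'd ?_ fun t ht => ?_)
      · intro q t ht
        obtain ⟨p, hp⟩ := mem_iUnion.1 ht
        rw [paste_of_mem hDd (k := ((p, q), false)) hp]; rfl
      by_cases htV : t ∈ ⋃ i, ⋃ p, H (p, i) true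
      · obtain ⟨i, hi⟩ := mem_iUnion.1 htV
        obtain ⟨p, hp⟩ := mem_iUnion.1 hi
        rw [paste_of_mem hDd (k := ((i, p), true)) hp, show f₁ t = a i from
          paste_of_mem (hcold true) hi]
        rfl
      · rw [show f₁ t = f t from paste_of_notMem htV, paste_of_notMem]
        intro hD
        obtain ⟨⟨⟨i, q⟩, _ | _⟩, hy⟩ := mem_iUnion.1 hD
        · exact ht (mem_iUnion.2 ⟨q, mem_iUnion.2 ⟨i, hy⟩⟩)
        · exact htV (mem_iUnion.2 ⟨i, mem_iUnion.2 ⟨q, hy⟩⟩)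
    have h4 := ih (fun q => ⋃ p, E p q) (fun i => ⋃ p, H (p, i) false)
      (fun q => MeasurableSet.iUnion fun p => hEm _ _) hA'd (hcolm false) (hcold false)
      (by rw [iUnion_comm, iUnion_congr hEU, iUnion_comm])
      (fun q => by
        rw [hcol, measure_iUnion (fun p p' hp => hEE (p, q) (p', q)
          fun h => hp (congrArg Prod.fst h)) fun p => hEm _ _]
        simp only [hEμ, hHμ, hhalf, hμA])
      a f₁ hf₁
    refine le_trans ?_ (h4.trans (h3.trans (h2.trans h1)))
    set g := paste (fun i => ⋃ p, H (p, i) false) (fun i => c * a i) f₁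
    have hVU : ∀ i, Disjoint (⋃ p, H (p, i) true) (⋃ i, ⋃ p, H (p, i) false) := fun i =>
      disjoint_iUnion_left.2 fun p => disjoint_iUnion_right.2 fun i' =>
        disjoint_iUnion_right.2 fun p' => hH _ _ _ _ (by simp)
    refine hM.average_le B hB hBd (measurable_paste (hcolm false) (hcold false) hf₁) ?_ ?_
    · intro i t ht
      rw [paste_of_mem hBd ht]
      have hdisj : Disjoint (⋃ p, H (p, i) false) (⋃ p, H (p, i) true) :=
        ((hVU i).mono_right (subset_iUnion (fun i => ⋃ p, H (p, i) false) i)).symm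
      calc ((1 + c) / 2 : ℝ≥0) * a i * μ (B i)
          = c * a i * (μ (B i) / 2) + a i * (μ (B i) / 2) := by
            rw [div_eq_mul_inv, div_eq_mul_inv, ENNReal.coe_mul,
              ENNReal.coe_inv two_ne_zero]
            push_cast; ring
        _ = ∫⁻ s in (⋃ p, H (p, i) false) ∪ ⋃ p, H (p, i) true, g s ∂μ := by
            rw [lintegral_union (hcolm true i) hdisj,
              lintegral_paste_cell (hcolm false) (hcold false), hcol,
              setLIntegral_congr_fun (hcolm true i) (g := fun _ => a i), setLIntegral_const, hcol]
            intro s hs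
            exact (paste_of_notMem (Set.disjoint_left.1 (hVU i) hs)).trans
              (paste_of_mem (hcold true) hs)
        _ ≤ ∫⁻ s in B i, g s ∂μ :=
            lintegral_mono_set (union_subset (hcolB _ _) (hcolB _ _))
    · intro t ht
      have hnot : ∀ j, t ∉ ⋃ i, ⋃ p, H (p, i) j := fun j h => ht (iUnion_mono (hcolB j) h)
      rw [paste_of_notMem ht]
      exact ((paste_of_notMem (hnot false)).trans (paste_of_notMem (hnot true))).ge

/-- Two step functions with the same values on cells of the same measures. -/
theorem IsAveragingGauge.rearrange (hM : IsAveragingGauge μ M) {ι : Type} [Countable ι]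
    [Nonempty ι] {A B : ι → Set ℝ} (hA : ∀ i, MeasurableSet (A i))
    (hAd : Pairwise (Function.onFun Disjoint A)) (hB : ∀ i, MeasurableSet (B i))
    (hBd : Pairwise (Function.onFun Disjoint B)) (hU : ⋃ i, A i = ⋃ i, B i)
    (hμ : ∀ i, μ (A i) = μ (B i)) (a : ι → ℝ≥0∞) {f : ℝ → ℝ≥0∞} (hf : Measurable f) :
    M (paste B a f) ≤ M (paste A a f) := by
  choose c hc h using hM.exists_rearrange_mul (ι := ι)
  have hq : ∀ n, (c n : ℝ) = 1 - 2⁻¹ ^ n := fun n => by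
    rw [eq_sub_iff_add_eq]; simpa using congrArg NNReal.toReal (hc n)
  have hq1 : Tendsto (fun n => (c n : ℝ≥0∞)) atTop (𝓝 1) := by
    rw [← ENNReal.coe_one, ENNReal.tendsto_coe, ← NNReal.tendsto_coe]
    simp only [hq]
    simpa using (tendsto_pow_atTop_nhds_zero_of_lt_one (r := (2⁻¹ : ℝ)) (by norm_num)
      (by norm_num)).const_sub 1
  refine ennreal_le_of_tendsto_one hq1 fun n => ?_
  have hq0 : (c n : ℝ≥0∞) ≤ 1 := by
    exact_mod_cast (hc n) ▸ (le_self_add : c n ≤ c n + 2⁻¹ ^ n)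
  rcases eq_or_ne (c n : ℝ≥0∞) 0 with h0 | h0
  · simp [h0]
  · refine (hM.mul_le _ h0 ENNReal.coe_ne_top).trans ?_
    refine le_trans (hM.mono_of_le ?_) (h n A B hA hAd hB hBd hU hμ a f hf)
    exact mul_paste_le hq0 hBd fun k => le_rfl

/-- Step functions that are related by a substochastic kernel. -/
theorem IsAveragingGauge.le_of_kernel (hM : IsAveragingGauge μ M) {ι κ : Type} [Countable ι]
    [Countable κ] {A : ι → Set ℝ} {B : κ → Set ℝ} (hA : ∀ i, MeasurableSet (A i))
    (hAd : Pairwise (Function.onFun Disjoint A)) (hB : ∀ n, MeasurableSet (B n))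
    (hBd : Pairwise (Function.onFun Disjoint B)) {k : κ → ι → ℝ≥0∞}
    (hkB : ∀ n, ∑' i, k n i ≤ μ (B n)) (hkA : ∀ i, ∑' n, k n i ≤ μ (A i)) {a : ι → ℝ≥0∞}
    {x y : ℝ → ℝ≥0∞} (hx : ∀ i, ∀ t ∈ A i, a i ≤ x t)
    (hy : ∀ n, ∀ t ∈ B n, y t * μ (B n) ≤ ∑' i, a i * k n i)
    (hoff : ∀ t ∉ ⋃ n, B n, y t = 0) : M y ≤ M x := by
  -- The transport plan: `EA i n ⊆ A i` is matched with `EB n i ⊆ B n`, both of measure `k n i`.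
  choose EA hEAm hEAs hEAd hEAμ using fun i => exists_disjoint_measure_eq (μ := μ) (hA i) (hkA i)
  choose EB hEBm hEBs hEBd hEBμ using fun n => exists_disjoint_measure_eq (μ := μ) (hB n) (hkB n)
  -- The rest of the line becomes one more cell, later given the value 0, so that both families have
  -- the same union. The two rests have equal measure.
  have extend : ∀ E : κ × ι → Set ℝ, (∀ x, MeasurableSet (E x)) →
      Pairwise (Function.onFun Disjoint E) → (∀ x, μ (E x) = k x.1 x.2) →
      ∃ E' : Option (κ × ι) → Set ℝ, (∀ x, E' (some x) = E x) ∧ (∀ x, MeasurableSet (E' x)) ∧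
        Pairwise (Function.onFun Disjoint E') ∧ ⋃ x, E' x = univ ∧
        μ (E' none) = μ univ - ∑' x : κ × ι, k x.1 x.2 := by
    intro E hE hd hEμ
    refine ⟨fun o => o.elim (⋃ x, E x)ᶜ E, fun x => rfl, ?_, ?_, ?_, ?_⟩
    · rintro (_ | x)
      exacts [(MeasurableSet.iUnion hE).compl, hE x]
    · rintro (_ | x) (_ | x') hne
      · exact absurd rfl hne
      · exact (disjoint_compl_right.mono_left (subset_iUnion E x')).symm
      · exact disjoint_compl_right.mono_left (subset_iUnion E x)
      · exact hd fun h => hne (by rw [h])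
    · rw [iUnion_option]
      exact compl_union_self _
    · change μ (⋃ x, E x)ᶜ = _
      rw [measure_compl (MeasurableSet.iUnion hE) (measure_ne_top _ _), measure_iUnion hd hE]
      simp only [hEμ]
  have hA'd : Pairwise (Function.onFun Disjoint fun x : κ × ι => EA x.2 x.1) := by
    rintro ⟨n, i⟩ ⟨n', i'⟩ hne
    by_cases hi : i = i'
    · subst hi
      exact hEAd i fun h => hne (by rw [show n = n' from h])
    · exact (hAd hi).mono (hEAs _ _) (hEAs _ _)
  have hB'd : Pairwise (Function.onFun Disjoint fun x : κ × ι => EB x.1 x.2) := by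
    rintro ⟨n, i⟩ ⟨n', i'⟩ hne
    by_cases hn : n = n'
    · subst hn
      exact hEBd n fun h => hne (by rw [show i = i' from h])
    · exact (hBd hn).mono (hEBs _ _) (hEBs _ _)
  obtain ⟨A', hA's, hA'm, hA'd, hA'U, hA'μ⟩ := extend _ (fun x => hEAm _ _) hA'd fun x => hEAμ _ _
  obtain ⟨B', hB's, hB'm, hB'd, hB'U, hB'μ⟩ := extend _ (fun x => hEBm _ _) hB'd fun x => hEBμ _ _
  let a' : Option (κ × ι) → ℝ≥0∞ := fun o => o.elim 0 fun x => a x.2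
  have h1 : M (paste A' a' 0) ≤ M x := by
    refine hM.mono_of_le (paste_cases (p := fun t z => z ≤ x t) hA'd ?_ fun t _ => zero_le)
    rintro (_ | ⟨n, i⟩) t ht
    · exact zero_le
    · rw [hA's] at ht
      exact hx i t (hEAs i n ht)
  have h2 : M (paste B' a' 0) ≤ M (paste A' a' 0) := by
    refine hM.rearrange hA'm hA'd hB'm hB'd (by rw [hA'U, hB'U]) ?_ a' measurable_const
    rintro (_ | x)
    · rw [hA'μ, hB'μ]
    · rw [hA's, hB's, hEAμ, hEBμ]
  refine le_trans ?_ (h2.trans h1)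
  refine hM.average_le B hB hBd (measurable_paste hB'm hB'd measurable_const) (fun n t ht => ?_)
    fun t ht => by simp [hoff t ht]
  refine (hy n t ht).trans ?_
  calc ∑' i, a i * k n i = ∑' i, ∫⁻ s in B' (some (n, i)), paste B' a' 0 s ∂μ := by
        refine tsum_congr fun i => ?_
        rw [lintegral_paste_cell hB'm hB'd, hB's, hEBμ]
        rfl
    _ = ∫⁻ s in ⋃ i, B' (some (n, i)), paste B' a' 0 s ∂μ :=
        (lintegral_iUnion (s := fun i => B' (some (n, i))) (fun i => hB'm _) (fun i j hij => hB'd (by simpa using hij)) _).symm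
    _ ≤ ∫⁻ s in B n, paste B' a' 0 s ∂μ :=
        lintegral_mono_set (iUnion_subset fun i => by rw [hB's]; exact hEBs n i)

end Rearrange

/-! ### Functionals on L¹ and kernels of operators. -/

section Functionals

theorem integrable_bdd_mul {φ : ℝ → ℝ} (hφ : Measurable φ) {C : ℝ} (hC : ∀ᵐ t ∂μ, |φ t| ≤ C)
    {u : ℝ → ℝ} (hu : Integrable u μ) : Integrable (fun t => φ t * u t) μ :=
  hu.bdd_mul (c := C) hφ.aestronglyMeasurable (by simpa [Real.norm_eq_abs] using hC)

/-- Integration against a bounded function is a bounded functional on `L¹`. -/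
theorem exists_functional_of_bdd {φ : ℝ → ℝ} (hφ : Measurable φ) {C : ℝ}
    (hC : ∀ᵐ t ∂μ, |φ t| ≤ C) :
    ∃ L : Lp ℝ 1 μ →L[ℝ] ℝ, ∀ u, L u = ∫ t, φ t * u t ∂μ := by
  have hint : ∀ u : Lp ℝ 1 μ, Integrable (fun t => φ t * u t) μ := fun u =>
    integrable_bdd_mul hφ hC (L1.integrable_coeFn u)
  refine ⟨LinearMap.mkContinuous
    { toFun := fun u => ∫ t, φ t * u t ∂μ
      map_add' := fun u v => ?_
      map_smul' := fun c u => ?_ } C fun u => ?_, fun u => rfl⟩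
  · rw [← integral_add (hint u) (hint v)]
    refine integral_congr_ae ?_
    filter_upwards [Lp.coeFn_add u v] with t ht
    rw [ht, Pi.add_apply, mul_add]
  · rw [RingHom.id_apply, smul_eq_mul, ← integral_const_mul]
    refine integral_congr_ae ?_
    filter_upwards [Lp.coeFn_smul c u] with t ht
    rw [ht, Pi.smul_apply, smul_eq_mul]
    ring
  · change ‖∫ t, φ t * u t ∂μ‖ ≤ C * ‖u‖
    rw [L1.norm_eq_integral_norm, ← integral_const_mul]
    refine norm_integral_le_of_norm_le ((L1.integrable_coeFn u).norm.const_mul C) ?_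
    filter_upwards [hC] with t ht
    rw [norm_mul]
    exact mul_le_mul_of_nonneg_right ht (norm_nonneg _)

variable [IsFiniteMeasure μ]

theorem ae_abs_le_of_setIntegral {φ : ℝ → ℝ} (hφ : Integrable φ μ) {C : ℝ}
    (h : ∀ s, MeasurableSet s → |∫ t in s, φ t ∂μ| ≤ C * μ.real s) : ∀ᵐ t ∂μ, |φ t| ≤ C := by
  have h1 : φ ≤ᵐ[μ] fun _ => C := by
    refine ae_le_of_forall_setIntegral_le hφ (integrable_const C) fun s hs _ => ?_
    rw [setIntegral_const, smul_eq_mul, mul_comm]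
    exact (le_abs_self _).trans (h s hs)
  have h2 : (fun t => -φ t) ≤ᵐ[μ] fun _ => C := by
    refine ae_le_of_forall_setIntegral_le hφ.neg (integrable_const C) fun s hs _ => ?_
    rw [setIntegral_const, smul_eq_mul, mul_comm, integral_neg]
    exact (neg_le_abs _).trans (h s hs)
  filter_upwards [h1, h2] with t ht ht'
  exact abs_le'.2 ⟨ht, ht'⟩

theorem norm_indicatorConstLp_one {s : Set ℝ} (hs : MeasurableSet s) :
    ‖indicatorConstLp 1 hs (measure_ne_top μ s) (1 : ℝ)‖ = μ.real s := by
  rw [norm_indicatorConstLp one_ne_zero ENNReal.one_ne_top]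
  simp

/-- Bounded functionals on `L¹` are represented by bounded functions. -/
theorem exists_representing (l : Lp ℝ 1 μ →L[ℝ] ℝ) :
    ∃ φ : ℝ → ℝ, Measurable φ ∧ (∀ᵐ t ∂μ, |φ t| ≤ ‖l‖) ∧ ∀ u, l u = ∫ t, φ t * u t ∂μ := by
  -- The inclusion of L² in L¹, as Hölder multiplication by 1. It pulls `l` back to L², where the
  -- Riesz theorem supplies `φ`.
  let J : Lp ℝ 2 μ →L[ℝ] Lp ℝ 1 μ :=
    (ContinuousLinearMap.mul ℝ ℝ).holderL μ 2 2 1 (Lp.const 2 μ (1 : ℝ))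
  have hJ : ∀ u : Lp ℝ 2 μ, (J u : ℝ → ℝ) =ᵐ[μ] u := fun u => by
    have h := (ContinuousLinearMap.mul ℝ ℝ).coeFn_holder (r := 1) (Lp.const 2 μ (1 : ℝ)) u
    filter_upwards [h, Lp.coeFn_const (p := 2) (μ := μ) (1 : ℝ)] with t ht ht'
    change (((ContinuousLinearMap.mul ℝ ℝ).holder 1 (Lp.const 2 μ (1 : ℝ)) u : Lp ℝ 1 μ) : ℝ → ℝ) t = u t
    rw [ht, ht']
    simp
  let φ : Lp ℝ 2 μ := (InnerProductSpace.toDual ℝ _).symm (l.comp J)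
  have hφi : Integrable φ μ := (Lp.memLp φ).integrable (by norm_num)
  have hφ : ∀ s (hs : MeasurableSet s),
      l (indicatorConstLp 1 hs (measure_ne_top μ s) (1 : ℝ)) = ∫ t in s, φ t ∂μ := fun s hs => by
    rw [← L2.inner_indicatorConstLp_one (𝕜 := ℝ) hs (measure_ne_top μ s) φ, real_inner_comm,
      InnerProductSpace.toDual_symm_apply, ContinuousLinearMap.comp_apply]
    congr 1
    refine Lp.ext ?_
    exact (indicatorConstLp_coeFn.trans indicatorConstLp_coeFn.symm).trans (hJ _).symm
  have hbd : ∀ᵐ t ∂μ, |φ t| ≤ ‖l‖ := ae_abs_le_of_setIntegral hφi fun s hs => by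
    rw [← hφ s hs, ← norm_indicatorConstLp_one hs]
    exact l.le_opNorm _
  have hφm : Measurable φ := (Lp.stronglyMeasurable φ).measurable
  obtain ⟨L, hL⟩ := exists_functional_of_bdd hφm hbd
  refine ⟨φ, hφm, hbd, fun u => ?_⟩
  rw [← hL]
  refine Lp.induction ENNReal.one_ne_top (motive := fun u => l u = L u) ?_ ?_ ?_ u
  · intro c s hs hμs
    have : (Lp.simpleFunc.indicatorConst 1 hs hμs.ne c : Lp ℝ 1 μ) =
        c • indicatorConstLp 1 hs (measure_ne_top μ s) (1 : ℝ) := by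
      rw [Lp.simpleFunc.coe_indicatorConst]
      refine Lp.ext ?_
      refine indicatorConstLp_coeFn.trans (EventuallyEq.trans ?_ (Lp.coeFn_smul _ _).symm)
      filter_upwards [indicatorConstLp_coeFn (p := 1) (hs := hs) (hμs := measure_ne_top μ s)
        (c := (1 : ℝ))] with t ht
      rw [Pi.smul_apply, ht]
      by_cases h : t ∈ s <;> simp [h]
    rw [this, map_smul, map_smul, hφ s hs, hL]
    congr 1
    rw [← integral_indicator hs]
    refine integral_congr_ae ?_
    filter_upwards [indicatorConstLp_coeFn (p := 1) (hs := hs) (hμs := measure_ne_top μ s)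
        (c := (1 : ℝ))] with t ht
    rw [ht]
    by_cases h : t ∈ s <;> simp [h]
  · intro f g hf hg _ h1 h2
    rw [map_add, map_add, h1, h2]
  · exact isClosed_eq l.continuous L.continuous

end Functionals

/-- The kernel of an operator with respect to countably many disjoint sets and a choice of signs:
functions `φ n` that represent the functionals `u ↦ ∫ s 1_{B n} T u`. -/
theorem exists_kernel {T : L1I →L[ℝ] L1I} {κ : Type} [Countable κ] {B : κ → Set ℝ}
    (hB : ∀ n, MeasurableSet (B n)) (hBd : Pairwise (Function.onFun Disjoint B)) {s : ℝ → ℝ}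
    (hs : Measurable s) (hs1 : ∀ t, |s t| ≤ 1) :
    ∃ φ : κ → ℝ → ℝ, (∀ n, Measurable (φ n)) ∧
      (∀ n u, ∫ t in B n, s t * T u t ∂lam = ∫ t, φ n t * u t ∂lam) ∧
      (∀ᵐ t ∂lam, ∑' n, ‖φ n t‖ₑ ≤ ‖T‖ₑ) ∧
      ∀ n, ∫⁻ t, ‖φ n t‖ₑ ∂lam ≤ supOpNorm T * lam (B n) := by
  classical
  have hsn : ∀ n, Measurable ((B n).indicator s) := fun n => hs.indicator (hB n)
  have hsn1 : ∀ n, ∀ᵐ t ∂lam, |(B n).indicator s t| ≤ 1 := fun n => ae_of_all _ fun t => by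
    by_cases h : t ∈ B n <;> simp [h, hs1]
  have hind : ∀ n (u : L1I), ∫ t in B n, s t * T u t ∂lam =
      ∫ t, (B n).indicator s t * T u t ∂lam := fun n u => by
    rw [← integral_indicator (hB n)]
    refine integral_congr_ae (ae_of_all _ fun t => ?_)
    by_cases h : t ∈ B n <;> simp [h]
  choose L hL using fun n => exists_functional_of_bdd (hsn n) (hsn1 n)
  choose φ hφm hφb hφ using fun n => exists_representing ((L n).comp T)
  have hφL : ∀ n u, ∫ t in B n, s t * T u t ∂lam = ∫ t, φ n t * u t ∂lam := fun n u => by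
    rw [hind, ← hL, ← hφ]; rfl
  have hφi : ∀ n, Integrable (φ n) lam := fun n => by
    simpa using integrable_bdd_mul (hφm n) (hφb n) (integrable_const (1 : ℝ))
  refine ⟨φ, hφm, hφL, ?_, fun n => ?_⟩
  · -- all sign patterns on finitely many cells
    have key : ∀ F P : Finset κ, ∀ᵐ t ∂lam,
        |∑ n ∈ F, (if n ∈ P then 1 else -1) * φ n t| ≤ ‖T‖ := by
      intro F P
      refine ae_abs_le_of_setIntegral (integrable_finsetSum _ fun n _ => (hφi n).const_mul _)
        fun E hE => ?_
      set u : L1I := indicatorConstLp 1 hE (measure_ne_top lam E) (1 : ℝ)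
      have hu : ∀ n, ∫ t in E, φ n t ∂lam = ∫ t, (B n).indicator s t * T u t ∂lam := fun n => by
        rw [← hind, hφL, ← integral_indicator hE]
        refine integral_congr_ae ?_
        filter_upwards [indicatorConstLp_coeFn (p := 1) (hs := hE) (hμs := measure_ne_top lam E)
          (c := (1 : ℝ))] with t ht
        rw [ht]
        by_cases h : t ∈ E <;> simp [h]
      have hTi : ∀ n, Integrable (fun t => (B n).indicator s t * T u t) lam := fun n =>
        integrable_bdd_mul (hsn n) (hsn1 n) (L1.integrable_coeFn _)
      rw [integral_finsetSum _ fun n _ => ((hφi n).const_mul _).integrableOn]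
      simp only [integral_const_mul, hu]
      simp only [← integral_const_mul]
      rw [← integral_finsetSum _ fun n _ => (hTi n).const_mul _]
      -- The cells are disjoint, so at each point at most one term is nonzero.
      calc |∫ t, ∑ n ∈ F, (if n ∈ P then 1 else -1) * ((B n).indicator s t * T u t) ∂lam|
          ≤ ∫ t, ‖T u t‖ ∂lam := by
            rw [← Real.norm_eq_abs]
            refine norm_integral_le_of_norm_le (L1.integrable_coeFn (T u)).norm
              (ae_of_all _ fun t => ?_)
            by_cases ht : ∃ n ∈ F, t ∈ B n
            · obtain ⟨n, hn, htn⟩ := ht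
              rw [Finset.sum_eq_single n]
              · rw [indicator_of_mem htn, norm_mul, norm_mul]
                have h1 : ‖(if n ∈ P then 1 else -1 : ℝ)‖ = 1 := by split_ifs <;> simp
                rw [h1, one_mul]
                exact mul_le_of_le_one_left (norm_nonneg _) (hs1 t)
              · intro m _ hmn
                rw [indicator_of_notMem fun h => Set.disjoint_left.1 (hBd hmn) h htn]
                simp
              · exact fun h => absurd hn h
            · rw [Finset.sum_eq_zero]
              · simp
              · intro n hn
                rw [indicator_of_notMem fun h => ht ⟨n, hn, h⟩]
                simp
        _ = ‖T u‖ := (L1.norm_eq_integral_norm _).symm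
        _ ≤ ‖T‖ * ‖u‖ := T.le_opNorm u
        _ = ‖T‖ * (lam).real E := by rw [norm_indicatorConstLp_one hE]
    -- There are countably many `F` and `P`, so `P` may be chosen depending on `t`.
    have key' := ae_all_iff.2 fun F => ae_all_iff.2 fun P => key F P
    filter_upwards [key'] with t ht
    rw [ENNReal.tsum_eq_iSup_sum]
    refine iSup_le fun F => ?_
    have h := ht F (F.filter fun n => 0 ≤ φ n t)
    rw [Finset.sum_congr rfl (g := fun n => |φ n t|)] at h
    · calc ∑ n ∈ F, ‖φ n t‖ₑ = ENNReal.ofReal (∑ n ∈ F, |φ n t|) := by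
            rw [ENNReal.ofReal_sum_of_nonneg fun _ _ => abs_nonneg _]
            simp [Real.enorm_eq_ofReal_abs]
        _ ≤ ENNReal.ofReal ‖T‖ := ENNReal.ofReal_le_ofReal ((le_abs_self _).trans h)
        _ = ‖T‖ₑ := ofReal_norm _
    · intro n hn
      by_cases h0 : 0 ≤ φ n t
      · simp [hn, h0, abs_of_nonneg h0]
      · simp [h0, abs_of_neg (not_le.1 h0)]
  -- Evaluated at the sign of `φ n`, the functional gives `∫ |φ n|`.
  · let σ : ℝ → ℝ := fun t => if 0 ≤ φ n t then 1 else -1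
    have hσm : Measurable σ :=
      Measurable.ite (measurableSet_le measurable_const (hφm n)) measurable_const measurable_const
    have hσb : ∀ t, ‖σ t‖ ≤ 1 := fun t => by
      by_cases h : 0 ≤ φ n t <;> simp [σ, h]
    have hσp : MemLp σ ∞ lam :=
      memLp_top_of_bound hσm.aestronglyMeasurable 1 (ae_of_all _ hσb)
    have hσp1 := hσp.mono_exponent (p := 1) le_top
    set u : L1I := hσp1.toLp
    have hu : (u : ℝ → ℝ) =ᵐ[lam] σ := hσp1.coeFn_toLp
    have hsup : supNorm u ≤ 1 := by
      rw [supNorm, eLpNorm_congr_ae hu]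
      refine (eLpNorm_le_of_ae_bound (ae_of_all _ hσb)).trans ?_
      simp
    have hTu : supNorm (T u) ≤ supOpNorm T :=
      le_iSup₂ (f := fun (f : L1I) (_ : supNorm f ≤ 1) => supNorm (T f)) u hsup
    calc ∫⁻ t, ‖φ n t‖ₑ ∂lam = ENNReal.ofReal (∫ t, |φ n t| ∂lam) := by
          rw [ofReal_integral_eq_lintegral_ofReal (hφi n).abs (ae_of_all _ fun _ => abs_nonneg _)]
          simp [Real.enorm_eq_ofReal_abs]
      _ = ENNReal.ofReal (∫ t in B n, s t * T u t ∂lam) := by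
          rw [hφL]
          congr 1
          refine integral_congr_ae ?_
          filter_upwards [hu] with t ht
          rw [ht]
          by_cases h : 0 ≤ φ n t
          · simp [σ, h, abs_of_nonneg h]
          · simp [σ, h, abs_of_neg (not_le.1 h)]
      _ ≤ ‖∫ t in B n, s t * T u t ∂lam‖ₑ := by
          rw [Real.enorm_eq_ofReal_abs]
          exact ENNReal.ofReal_le_ofReal (le_abs_self _)
      _ ≤ ∫⁻ t in B n, ‖s t * T u t‖ₑ ∂lam := enorm_integral_le_lintegral_enorm _
      _ ≤ ∫⁻ _ in B n, supOpNorm T ∂lam := by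
          refine lintegral_mono_ae (ae_restrict_of_ae ?_)
          filter_upwards [ae_le_eLpNormEssSup (f := (T u : ℝ → ℝ)) (μ := lam)] with t ht
          rw [enorm_mul]
          refine le_trans ?_ ((ht.trans_eq eLpNorm_exponent_top.symm).trans hTu)
          refine mul_le_of_le_one_left' ?_
          rw [Real.enorm_eq_ofReal_abs]
          exact ENNReal.ofReal_le_one.2 (hs1 t)
      _ = supOpNorm T * lam (B n) := setLIntegral_const _ _

/-- An operator is bounded in every averaging gauge by the larger one of its two norms. -/
theorem IsAveragingGauge.enorm_apply_le (hM : IsAveragingGauge lam M)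
    {T : L1I →L[ℝ] L1I} {C : ℝ≥0∞} (hC0 : C ≠ 0) (hC : C ≠ ∞) (hT1 : ‖T‖ₑ ≤ C)
    (hT2 : supOpNorm T ≤ C) (x : L1I) :
    M (fun t => ‖T x t‖ₑ) ≤ C * M fun t => ‖x t‖ₑ := by
  -- Two ratios are used: `r` for the level sets of `|x|` and `ρ` for those of `|T x|`.
  refine ennreal_le_of_forall_one_lt_mul fun r hr hr' => ?_
  rw [mul_left_comm]
  refine ennreal_le_of_forall_one_lt_mul fun ρ hρ hρ' => ?_
  have hr0 : r ≠ 0 := (zero_lt_one.trans hr).ne'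
  have hρ0 : ρ ≠ 0 := (zero_lt_one.trans hρ).ne'
  have hxm : Measurable (x : ℝ → ℝ) := (Lp.stronglyMeasurable x).measurable
  have hym : Measurable (T x : ℝ → ℝ) := (Lp.stronglyMeasurable (T x)).measurable
  set X : ℝ → ℝ≥0∞ := fun t => ‖x t‖ₑ
  set Y : ℝ → ℝ≥0∞ := fun t => ‖T x t‖ₑ
  have hX : Measurable X := hxm.enorm
  have hY : Measurable Y := hym.enorm
  have hAm := measurableSet_levelCell (r := r) hX
  have hAd := pairwise_disjoint_levelCell (f := X) hr hr'
  have hBm := measurableSet_levelCell (r := ρ) hY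
  have hBd := pairwise_disjoint_levelCell (f := Y) hρ hρ'
  choose a ha using exists_level hr hr' X
  choose b hb using exists_level hρ hρ' Y
  -- With this sign as weight, the functional of a cell evaluated at `x` is the integral of `|T x|`
  -- over the cell.
  let s : ℝ → ℝ := fun t => if 0 ≤ T x t then 1 else -1
  have hs : Measurable s :=
    Measurable.ite (measurableSet_le measurable_const hym) measurable_const measurable_const
  have hs1 : ∀ t, |s t| ≤ 1 := fun t => by by_cases h : 0 ≤ T x t <;> simp [s, h]
  have hsY : ∀ t, ENNReal.ofReal (s t * T x t) = Y t := fun t => by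
    simp only [Y, Real.enorm_eq_ofReal_abs]
    by_cases h : 0 ≤ T x t
    · simp [s, h, abs_of_nonneg h]
    · simp [s, h, abs_of_neg (not_le.1 h)]
  have hs0 : ∀ t, 0 ≤ s t * T x t := fun t => by
    by_cases h : 0 ≤ T x t
    · simp [s, h]
    · simp [s, h, (not_le.1 h).le]
  obtain ⟨φ, hφm, hφ, hφ1, hφ2⟩ := exists_kernel (T := T) hBm hBd hs hs1
  have hφe : ∀ n, Measurable fun t => ‖φ n t‖ₑ := fun n => (hφm n).enorm
  have hsplit : ∀ F : ℝ → ℝ≥0∞,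
      ∑' i, ∫⁻ t in levelCell X r i, F t ∂lam = ∫⁻ t, F t ∂lam := fun F => by
    rw [← lintegral_iUnion hAm hAd, iUnion_levelCell hr hr', setLIntegral_univ]
  have hYi : ∀ n, ∫⁻ t in levelCell Y ρ n, Y t ∂lam ≤
      ∑' i, a i * ∫⁻ t in levelCell X r i, ‖φ n t‖ₑ ∂lam := by
    intro n
    have hint : Integrable (fun t => s t * T x t) lam :=
      integrable_bdd_mul hs (ae_of_all _ hs1) (L1.integrable_coeFn _)
    calc ∫⁻ t in levelCell Y ρ n, Y t ∂lam
        = ENNReal.ofReal (∫ t in levelCell Y ρ n, s t * T x t ∂lam) := by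
          rw [ofReal_integral_eq_lintegral_ofReal hint.integrableOn (ae_of_all _ hs0)]
          simp only [hsY]
      _ ≤ ‖∫ t, φ n t * x t ∂lam‖ₑ := by
          rw [hφ, Real.enorm_eq_ofReal_abs]
          exact ENNReal.ofReal_le_ofReal (le_abs_self _)
      _ ≤ ∫⁻ t, ‖φ n t * x t‖ₑ ∂lam := enorm_integral_le_lintegral_enorm _
      _ = ∑' i, ∫⁻ t in levelCell X r i, ‖φ n t * x t‖ₑ ∂lam := (hsplit _).symm
      _ ≤ ∑' i, a i * ∫⁻ t in levelCell X r i, ‖φ n t‖ₑ ∂lam := by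
          refine ENNReal.tsum_le_tsum fun i => ?_
          rw [← lintegral_const_mul _ (hφe n)]
          refine setLIntegral_mono ((hφe n).const_mul _) fun t ht => ?_
          rw [enorm_mul, mul_comm]
          exact mul_le_mul_left (ha i t ht).1 _
  -- The L^∞ bound on `T` controls the row sums of the kernel and the L¹ bound its column sums.
  have key : M (fun t => (ρ * C)⁻¹ * Y t) ≤ M fun t => r * X t := by
    refine hM.le_of_kernel hAm hAd hBm hBd
      (k := fun n i => (∫⁻ t in levelCell X r i, ‖φ n t‖ₑ ∂lam) / C) (a := a) ?_ ?_ ?_ ?_ ?_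
    · intro n
      simp only [div_eq_mul_inv, ENNReal.tsum_mul_right, hsplit]
      rw [← div_eq_mul_inv]
      refine ENNReal.div_le_of_le_mul' ((hφ2 n).trans ?_)
      gcongr
    · intro i
      simp only [div_eq_mul_inv, ENNReal.tsum_mul_right]
      rw [← div_eq_mul_inv, ← lintegral_tsum fun n => (hφe n).aemeasurable]
      refine ENNReal.div_le_of_le_mul' ?_
      rw [← setLIntegral_const]
      refine lintegral_mono_ae (ae_restrict_of_ae ?_)
      filter_upwards [hφ1] with t ht using ht.trans hT1
    · exact fun i t ht => (ha i t ht).2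
    · intro n t ht
      have h1 : Y t * lam (levelCell Y ρ n) ≤ ρ * ∫⁻ t in levelCell Y ρ n, Y t ∂lam := by
        rw [← lintegral_const_mul _ hY, ← setLIntegral_const]
        exact setLIntegral_mono (hY.const_mul _) fun u hu => (hb n t ht).1.trans (hb n u hu).2
      rw [mul_assoc, ← ENNReal.div_eq_inv_mul]
      refine ENNReal.div_le_of_le_mul' (h1.trans ?_)
      simp only [div_eq_mul_inv, ← mul_assoc, ENNReal.tsum_mul_right]
      calc ρ * ∫⁻ t in levelCell Y ρ n, Y t ∂lam
          ≤ ρ * ∑' i, a i * ∫⁻ t in levelCell X r i, ‖φ n t‖ₑ ∂lam := by gcongr; exact hYi n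
        _ = ρ * (C * C⁻¹) * ∑' i, a i * ∫⁻ t in levelCell X r i, ‖φ n t‖ₑ ∂lam := by
            rw [ENNReal.mul_inv_cancel hC0 hC, mul_one]
        _ = _ := by ring
    · intro t ht
      exact absurd (iUnion_levelCell hρ hρ' ▸ mem_univ t) ht
  have h1 := (hM.mul_le Y (ENNReal.inv_ne_zero.2 (ENNReal.mul_ne_top hρ' hC))
    (ENNReal.inv_ne_top.2 (mul_ne_zero hρ0 hC0))).trans key
  have h2 := hM.mul_le (fun t => r * X t) (ENNReal.inv_ne_zero.2 hr') (ENNReal.inv_ne_top.2 hr0)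
  simp only [← mul_assoc, ENNReal.inv_mul_cancel hr0 hr', one_mul] at h2
  rw [← ENNReal.div_eq_inv_mul] at h1 h2
  rw [ENNReal.div_le_iff (mul_ne_zero hρ0 hC0) (ENNReal.mul_ne_top hρ' hC)] at h1
  rw [ENNReal.div_le_iff hr0 hr'] at h2
  calc M Y ≤ M (fun t => r * X t) * (ρ * C) := h1
    _ ≤ M X * r * (ρ * C) := by gcongr
    _ = ρ * (C * (r * M X)) := by ring

/-- The norm of an admissible operator on `L^∞` is finite, by the closed graph theorem. -/
theorem IsAdmissible.supOpNorm_lt_top {T : L1I →L[ℝ] L1I} (hT : IsAdmissible T) :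
    supOpNorm T < ∞ := by
  let J : Lp ℝ ∞ lam →L[ℝ] L1I :=
    (ContinuousLinearMap.mul ℝ ℝ).holderL lam 1 ∞ 1 (Lp.const 1 lam (1 : ℝ))
  have hJ : ∀ u : Lp ℝ ∞ lam, (J u : ℝ → ℝ) =ᵐ[lam] u := fun u => by
    have h := (ContinuousLinearMap.mul ℝ ℝ).coeFn_holder (r := 1) (Lp.const 1 lam (1 : ℝ)) u
    filter_upwards [h, Lp.coeFn_const (p := 1) (μ := lam) (1 : ℝ)] with t ht ht'
    change (((ContinuousLinearMap.mul ℝ ℝ).holder 1 (Lp.const 1 lam (1 : ℝ)) u : L1I) : ℝ → ℝ) t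
      = u t
    rw [ht, ht']
    simp
  have hmem : ∀ f : L1I, supNorm f < ∞ → MemLp f ∞ lam := fun f hf =>
    ⟨Lp.aestronglyMeasurable f, hf⟩
  have hJs : ∀ u : Lp ℝ ∞ lam, supNorm (J u) = ‖u‖ₑ := fun u => by
    rw [supNorm, eLpNorm_congr_ae (hJ u), Lp.enorm_def]
  have hsurj : ∀ f : L1I, supNorm f < ∞ → ∃ u, J u = f := fun f hf =>
    ⟨(hmem f hf).toLp, Lp.ext ((hJ _).trans (hmem f hf).coeFn_toLp)⟩
  have hinj : Function.Injective J := fun u v h =>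
    Lp.ext ((hJ u).symm.trans (EventuallyEq.trans (by rw [h]) (hJ v)))
  choose S hS using fun u => hsurj (T (J u)) (hT _ (by rw [hJs]; exact enorm_lt_top))
  let S' : Lp ℝ ∞ lam →ₗ[ℝ] Lp ℝ ∞ lam :=
    { toFun := S
      map_add' := fun u v => hinj (by simp [hS])
      map_smul' := fun c u => hinj (by simp [hS]) }
  have hcont : Continuous S' := by
    -- Limits in L^∞ are limits in L¹, where `T` is continuous, and `J` is injective.
    refine S'.continuous_of_seq_closed_graph fun u x y hu hSu => hinj ?_
    refine tendsto_nhds_unique ((J.continuous.tendsto y).comp hSu) ?_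
    have h1 := ((T.comp J).continuous.tendsto x).comp hu
    have h2 : J (S' x) = (T.comp J) x := hS x
    rw [h2]
    refine h1.congr fun n => (hS (u n)).symm
  let S'' : Lp ℝ ∞ lam →L[ℝ] Lp ℝ ∞ lam := ⟨S', hcont⟩
  refine lt_of_le_of_lt (iSup₂_le fun f hf => ?_) (enorm_lt_top (x := S''))
  obtain ⟨u, rfl⟩ := hsurj f (hf.trans_lt ENNReal.one_lt_top)
  rw [← hS, hJs]
  rw [hJs] at hf
  refine ((S''.le_opENorm u).trans ?_)
  exact mul_le_of_le_one_right' hf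

theorem abs_le_abs_iff {x y : L1I} : |x| ≤ |y| ↔ ∀ᵐ t ∂lam, ‖x t‖ₑ ≤ ‖y t‖ₑ := by
  rw [← Lp.coeFn_le]
  constructor <;> intro h <;>
    filter_upwards [h, Lp.coeFn_abs x, Lp.coeFn_abs y] with t ht hx hy
  · rw [hx, hy] at ht
    rwa [enorm_le_iff_norm_le]
  · rw [hx, hy]
    rwa [enorm_le_iff_norm_le] at ht

/-! ### Conditional expectations and double stochastic operators. -/

section Averages

variable (F : CountablePartition)

/-- The sets with this property form a σ-algebra containing the cells. Hence `F.sigma`-measurable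
functions are constant on each cell. -/
theorem CountablePartition.cell_subset_or_disjoint {s : Set ℝ} (hs : MeasurableSet[F.sigma] s) (n : ℕ) :
    F.cell n ⊆ s ∨ Disjoint (F.cell n) s := by
  induction s, hs using MeasurableSpace.generateFrom_induction with
  | hC s hs _ =>
    obtain ⟨m, rfl⟩ := hs
    by_cases h : n = m
    · exact Or.inl (by rw [h])
    · exact Or.inr (F.disjoint_cell h)
  | empty => exact Or.inr (disjoint_empty _)
  | compl s _ ih =>
    rcases ih with h | h
    · exact Or.inr (disjoint_compl_right.mono_left h)
    · exact Or.inl h.subset_compl_right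
  | iUnion s _ ih =>
    by_cases h : ∃ i, F.cell n ⊆ s i
    · obtain ⟨i, hi⟩ := h
      exact Or.inl (hi.trans (subset_iUnion s i))
    · exact Or.inr (disjoint_iUnion_right.2 fun i => (ih i).resolve_left fun hi => h ⟨i, hi⟩)

theorem CountablePartition.avg_ae_eq (x : L1I) : F.avg x =ᵐ[lam] lam[x | F.sigma] := by
  have h := condExp_ae_eq_condExpL1CLM F.sigma_le (L1.integrable_coeFn x)
  rw [Integrable.toL1_coeFn] at h
  exact h.symm

theorem CountablePartition.avg_nonneg {x : L1I} (hx : 0 ≤ x) : 0 ≤ F.avg x := by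
  rw [← Lp.coeFn_nonneg] at hx ⊢
  filter_upwards [F.avg_ae_eq x, condExp_nonneg (m := F.sigma) hx] with t ht h
  rwa [ht]

/-- The product form makes null cells no exception. -/
theorem CountablePartition.enorm_avg_mul {x : L1I} (hx : 0 ≤ x) :
    ∀ᵐ t ∂lam, ∀ n, t ∈ F.cell n →
      ‖F.avg x t‖ₑ * lam (F.cell n) = ∫⁻ s in F.cell n, ‖x s‖ₑ ∂lam := by
  set h : ℝ → ℝ := lam[x | F.sigma]
  have hm : StronglyMeasurable[F.sigma] h := stronglyMeasurable_condExp
  have h0 : 0 ≤ᵐ[lam] h := condExp_nonneg (by rwa [← Lp.coeFn_nonneg] at hx)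
  have hx0 : 0 ≤ᵐ[lam] x := by rwa [← Lp.coeFn_nonneg] at hx
  have hconst : ∀ n, ∀ t ∈ F.cell n, ∀ u ∈ F.cell n, h u = h t := by
    intro n t ht u hu
    have hms : MeasurableSet[F.sigma] (h ⁻¹' {h t}) := hm.measurable (measurableSet_singleton _)
    rcases F.cell_subset_or_disjoint hms n with h | h
    · exact h hu
    · exact absurd rfl (Set.disjoint_left.1 h ht)
  have hlin : ∀ f : ℝ → ℝ, Integrable f lam → 0 ≤ᵐ[lam] f → ∀ n,
      ∫⁻ s in F.cell n, ‖f s‖ₑ ∂lam = ENNReal.ofReal (∫ s in F.cell n, f s ∂lam) := by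
    intro f hf hf0 n
    rw [ofReal_integral_eq_lintegral_ofReal hf.integrableOn (ae_restrict_of_ae hf0)]
    refine lintegral_congr_ae (ae_restrict_of_ae ?_)
    filter_upwards [hf0] with s hs
    rw [Real.enorm_eq_ofReal_abs, abs_of_nonneg hs]
  filter_upwards [F.avg_ae_eq x] with t ht n htn
  have hcell : MeasurableSet[F.sigma] (F.cell n) :=
    MeasurableSpace.measurableSet_generateFrom ⟨n, rfl⟩
  calc ‖F.avg x t‖ₑ * lam (F.cell n) = ∫⁻ s in F.cell n, ‖h s‖ₑ ∂lam := by
        rw [ht, setLIntegral_congr_fun (F.measurable_cell n) (g := fun _ => ‖h t‖ₑ),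
          setLIntegral_const]
        intro s hs
        simp only [hconst n t htn s hs]
    _ = ∫⁻ s in F.cell n, ‖x s‖ₑ ∂lam := by
        rw [hlin h integrable_condExp h0, hlin x (L1.integrable_coeFn x) hx0,
          setIntegral_condExp F.sigma_le (L1.integrable_coeFn x) hcell]

end Averages

section DoubleStochastic

variable {T : L1I →L[ℝ] L1I}

theorem abs_apply_le (hT : ∀ f : L1I, 0 ≤ f → 0 ≤ T f) (f : L1I) : |T f| ≤ T |f| := by
  have h1 := hT (|f| - f) (sub_nonneg.2 (le_abs_self f))
  have h2 := hT (|f| + f) (by rw [← neg_le_iff_add_nonneg']; exact neg_le.1 (neg_le_abs f))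
  rw [map_sub, sub_nonneg] at h1
  rw [map_add, ← neg_le_iff_add_nonneg'] at h2
  exact abs_le'.2 ⟨h1, neg_le.1 h2⟩

theorem supNorm_apply_le (hT : ∀ f : L1I, 0 ≤ f → 0 ≤ T f) (h1 : T oneL1 = oneL1) (f : L1I) :
    supNorm (T f) ≤ supNorm f := by
  rcases eq_or_ne (supNorm f) ∞ with h | h
  · rw [h]; exact le_top
  set c := (supNorm f).toReal
  have hone : ∀ᵐ t ∂lam, (c • oneL1 : L1I) t = c := by
    filter_upwards [Lp.coeFn_smul c oneL1, Lp.coeFn_const (p := 1) (μ := lam) (1 : ℝ)] with t ht ht'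
    rw [ht, Pi.smul_apply, show (oneL1 : L1I) t = 1 from ht']
    simp
  have hf : |f| ≤ c • oneL1 := by
    rw [← Lp.coeFn_le]
    filter_upwards [hone, Lp.coeFn_abs f, ae_le_eLpNormEssSup (f := (f : ℝ → ℝ)) (μ := lam)]
      with t ht ht' hs
    rw [ht, ht']
    rw [← eLpNorm_exponent_top] at hs
    exact (ENNReal.ofReal_le_iff_le_toReal h).1 (by rwa [← Real.enorm_eq_ofReal_abs])
  have hTf : |T f| ≤ c • oneL1 := by
    refine (abs_apply_le hT f).trans ?_
    have := hT _ (sub_nonneg.2 hf)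
    rwa [map_sub, map_smul, h1, sub_nonneg] at this
  rw [← Lp.coeFn_le] at hTf
  rw [← ENNReal.ofReal_toReal h, supNorm, eLpNorm_exponent_top]
  refine eLpNormEssSup_le_of_ae_bound ?_
  filter_upwards [hTf, hone, Lp.coeFn_abs (T f)] with t ht h1 h2
  rwa [h1, h2] at ht

theorem IsDoubleStochastic.enorm_le_one (hT : IsDoubleStochastic T) : ‖T‖ₑ ≤ 1 := by
  have : ‖T‖ ≤ 1 := by
    refine T.opNorm_le_bound zero_le_one fun f => ?_
    rw [one_mul, L1.norm_eq_integral_norm, L1.norm_eq_integral_norm]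
    calc ∫ t, ‖T f t‖ ∂lam ≤ ∫ t, T |f| t ∂lam := by
          refine integral_mono_ae (L1.integrable_coeFn _).norm (L1.integrable_coeFn _) ?_
          have h := (Lp.coeFn_le _ _).2 (abs_apply_le hT.positive f)
          filter_upwards [h, Lp.coeFn_abs (T f)] with t ht ht'
          rwa [ht'] at ht
      _ = ∫ t, ‖f t‖ ∂lam := by
          rw [hT.adjoint_one]
          exact integral_congr_ae (Lp.coeFn_abs f)
  rw [← ofReal_norm]
  exact ENNReal.ofReal_le_one.2 this

theorem IsDoubleStochastic.supOpNorm_le_one (hT : IsDoubleStochastic T) : supOpNorm T ≤ 1 :=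
  iSup₂_le fun f hf => (supNorm_apply_le hT.positive hT.map_one f).trans hf

theorem CountablePartition.isDoubleStochasticProjection_avg (F : CountablePartition) :
    IsDoubleStochasticProjection F.avg := by
  have hone : F.avg oneL1 = oneL1 := by
    refine Lp.ext ((F.avg_ae_eq _).trans ?_)
    have h := Lp.coeFn_const (p := 1) (μ := lam) (1 : ℝ)
    refine (condExp_congr_ae h).trans (EventuallyEq.trans ?_ h.symm)
    rw [show Function.const ℝ (1 : ℝ) = fun _ => 1 from rfl, condExp_const F.sigma_le]
  refine ⟨⟨fun f hf => ?_, fun f hf => F.avg_nonneg hf, hone, fun f => ?_⟩, fun f => ?_⟩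
  · exact (supNorm_apply_le (fun f hf => F.avg_nonneg hf) hone f).trans_lt hf
  · rw [integral_congr_ae (F.avg_ae_eq f), integral_condExp F.sigma_le]
  · exact condExpL1CLM_of_aestronglyMeasurable' _ (aestronglyMeasurable_condExpL1CLM f)

end DoubleStochastic

/-! ### The gauge of an ideal and the interpolation property. -/

section Interpolation

variable {X : Submodule ℝ L1I} {N : Seminorm ℝ X}

/-- The smallest norm of an element of `X` that dominates the given function. -/
noncomputable def dominationGauge (X : Submodule ℝ L1I) (N : Seminorm ℝ X) (f : ℝ → ℝ≥0∞) : ℝ≥0∞ :=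
  ⨅ (x : X) (_ : f ≤ᵐ[lam] fun t => ‖(x : L1I) t‖ₑ), ENNReal.ofReal (N x)

theorem dominationGauge_le (x : X) {f : ℝ → ℝ≥0∞} (h : f ≤ᵐ[lam] fun t => ‖(x : L1I) t‖ₑ) :
    dominationGauge X N f ≤ ENNReal.ofReal (N x) :=
  iInf₂_le x h

/-- If `x` dominates `f`, the conditional expectation of `|x|` dominates almost everywhere every `g`
allowed in `average`, and its norm is at most `N x`. -/
theorem isAveragingGauge_dominationGauge (hX : IsOrderIdeal X)
    (hN : ∀ x y : X, |(y : L1I)| ≤ |(x : L1I)| → N y ≤ N x)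
    (havg : ∀ F : CountablePartition, NormLeOn F.avg X N 1) :
    IsAveragingGauge lam (dominationGauge X N) where
  mono h := le_iInf₂ fun x hx => dominationGauge_le x (h.trans hx)
  mul_le {c} f hc0 hc := by
    refine le_iInf₂ fun x hx => ?_
    have hc' : 0 < c.toReal := ENNReal.toReal_pos hc0 hc
    have h1 : dominationGauge X N f ≤ ENNReal.ofReal (N (c.toReal⁻¹ • x)) := by
      refine dominationGauge_le _ ?_
      filter_upwards [hx, Lp.coeFn_smul c.toReal⁻¹ (x : L1I)] with t ht ht'
      rw [Submodule.coe_smul, ht', Pi.smul_apply, smul_eq_mul, enorm_mul,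
        Real.enorm_eq_ofReal (inv_nonneg.2 hc'.le), ENNReal.ofReal_inv_of_pos hc',
        ENNReal.ofReal_toReal hc, ← ENNReal.div_eq_inv_mul]
      exact (ENNReal.le_div_iff_mul_le (Or.inl hc0) (Or.inl hc)).2 (by rwa [mul_comm])
    calc c * dominationGauge X N f ≤ c * ENNReal.ofReal (N (c.toReal⁻¹ • x)) := by gcongr
      _ = c * (c⁻¹ * ENNReal.ofReal (N x)) := by
          rw [map_smul_eq_mul, norm_inv, Real.norm_of_nonneg hc'.le,
            ENNReal.ofReal_mul (inv_nonneg.2 hc'.le), ENNReal.ofReal_inv_of_pos hc',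
            ENNReal.ofReal_toReal hc]
      _ = ENNReal.ofReal (N x) := by
          rw [← mul_assoc, ENNReal.mul_inv_cancel hc0 hc, one_mul]
  average {ι} _ C hC hd hU f g hf hg := by
    refine le_iInf₂ fun x hx => ?_
    obtain ⟨e, he⟩ := exists_injective_nat ι
    have hcell : ∀ i, (⋃ (j : ι) (_ : e j = e i), C j) = C i := fun i =>
      Subset.antisymm (iUnion₂_subset fun j hj => by rw [he hj]) (subset_iUnion₂_of_subset i rfl Subset.rfl)
    -- The cells are numbered by `e`; numbers outside its range get empty cells.
    let F : CountablePartition :=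
      { cell := fun n => (⋃ (j : ι) (_ : e j = n), C j) ∩ Ioc 0 1
        measurable_cell := fun n =>
          (MeasurableSet.iUnion fun j => MeasurableSet.iUnion fun _ => hC j).inter measurableSet_Ioc
        disjoint_cell := fun m n hmn => by
          refine Disjoint.mono inter_subset_left inter_subset_left ?_
          refine disjoint_iUnion₂_left.2 fun i hi => disjoint_iUnion₂_right.2 fun j hj => hd ?_
          rintro rfl
          exact hmn (hi.symm.trans hj)
        iUnion_cell := by
          rw [← iUnion_inter]
          refine inter_eq_right.2 fun t _ => ?_
          obtain ⟨i, hi⟩ := mem_iUnion.1 (hU.symm ▸ mem_univ t)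
          exact mem_iUnion.2 ⟨e i, mem_iUnion₂.2 ⟨i, rfl, hi⟩⟩ }
    have hF : ∀ i, F.cell (e i) = C i ∩ Ioc 0 1 := fun i => congrArg (· ∩ Ioc (0 : ℝ) 1) (hcell i)
    have hFr : ∀ i, (lam).restrict (F.cell (e i)) = (lam).restrict (C i) := fun i => by
      rw [hF, Measure.restrict_restrict ((hC i).inter measurableSet_Ioc),
        Measure.restrict_restrict (hC i), inter_assoc, inter_self]
    have hFm : ∀ i, lam (F.cell (e i)) = lam (C i) := fun i => by
      rw [← Measure.restrict_apply_univ, hFr, Measure.restrict_apply_univ]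
    have habs : |(x : L1I)| ∈ X := hX.solid x _ x.2 (by rw [abs_abs])
    obtain ⟨hmem, hle⟩ := havg F ⟨|(x : L1I)|, habs⟩
    rw [one_mul] at hle
    have hNabs : N ⟨|(x : L1I)|, habs⟩ ≤ N x := hN _ _ (by simp)
    refine le_trans (dominationGauge_le ⟨_, hmem⟩ ?_) (hle.trans (ENNReal.ofReal_le_ofReal hNabs))
    have hIoc : ∀ᵐ t ∂lam, t ∈ Ioc (0 : ℝ) 1 := ae_restrict_mem measurableSet_Ioc
    have hnull : ∀ᵐ t ∂lam, ∀ i, lam (C i) = 0 → t ∉ C i :=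
      ae_all_iff.2 fun i => by
        by_cases hi : lam (C i) = 0
        · filter_upwards [measure_eq_zero_iff_ae_notMem.1 hi] with t ht _ using ht
        · exact ae_of_all _ fun t h => absurd h hi
    filter_upwards [F.enorm_avg_mul (abs_nonneg (x : L1I)), hIoc, hnull] with t ht htI ht0
    obtain ⟨i, hi⟩ := mem_iUnion.1 (hU.symm ▸ mem_univ t)
    have h1 := ht (e i) (by rw [hF]; exact ⟨hi, htI⟩)
    rw [hFm, hFr] at h1
    refine (ENNReal.mul_le_mul_iff_left (fun h => ht0 i h hi) (measure_ne_top _ _)).1 ?_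
    refine (hg i t hi).trans (le_trans (lintegral_mono_ae (ae_restrict_of_ae ?_)) h1.ge)
    filter_upwards [hx, Lp.coeFn_abs (x : L1I)] with s hs hs'
    rw [hs']
    simpa using hs

/-- Contractivity of the averaging operators implies the interpolation property. -/
theorem normLeOn_of_avg (hX : IsOrderIdeal X)
    (hN : ∀ x y : X, |(y : L1I)| ≤ |(x : L1I)| → N y ≤ N x)
    (havg : ∀ F : CountablePartition, NormLeOn F.avg X N 1) {T : L1I →L[ℝ] L1I}
    (hT : IsAdmissible T) : NormLeOn T X N (max ‖T‖ₑ (supOpNorm T)) := by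
  intro x
  have hM := isAveragingGauge_dominationGauge hX hN havg
  -- The gauge estimate needs a nonzero constant, so `T = 0` is treated apart.
  by_cases hC0 : max ‖T‖ₑ (supOpNorm T) = 0
  · have hT0 : T = 0 := by
      have h : ‖T‖ₑ ≤ 0 := hC0 ▸ le_max_left _ _
      rw [← ofReal_norm, nonpos_iff_eq_zero, ENNReal.ofReal_eq_zero] at h
      exact norm_le_zero_iff.1 h
    subst hT0
    refine ⟨X.zero_mem, ?_⟩
    have : (⟨(0 : L1I →L[ℝ] L1I) x, X.zero_mem⟩ : X) = 0 := rfl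
    rw [this, map_zero, ENNReal.ofReal_zero]
    exact zero_le
  have hC : max ‖T‖ₑ (supOpNorm T) ≠ ∞ := (max_lt enorm_lt_top hT.supOpNorm_lt_top).ne
  have h1 := (hM.enorm_apply_le hC0 hC (le_max_left _ _) (le_max_right _ _) (x : L1I)).trans
    (mul_le_mul_right (dominationGauge_le x (EventuallyLE.refl _ _)) _)
  -- A finite gauge means that some element of `X` dominates `T x`; solidity then puts `T x` in `X`.
  have hlt := h1.trans_lt (ENNReal.mul_lt_top hC.lt_top ENNReal.ofReal_lt_top)
  obtain ⟨z, hz⟩ := iInf_lt_iff.1 hlt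
  obtain ⟨hz, -⟩ := iInf_lt_iff.1 hz
  have hmem : T x ∈ X := hX.solid z _ z.2 (abs_le_abs_iff.2 hz)
  -- By monotonicity the norm of `T x` is a lower bound for the norms of all dominating elements,
  -- hence for the gauge.
  refine ⟨hmem, le_trans (le_iInf₂ fun w hw => ?_) h1⟩
  exact ENNReal.ofReal_le_ofReal (hN _ _ (abs_le_abs_iff.2 hw))

theorem NormLeOn.mono {T : L1I →L[ℝ] L1I} {C C' : ℝ≥0∞} (h : NormLeOn T X N C) (hC : C ≤ C') :
    NormLeOn T X N C' := fun x =>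
  ⟨(h x).1, (h x).2.trans (mul_le_mul_left hC _)⟩

/-- For the seminorm 0 the norm estimates are trivial and only membership remains. -/
theorem preserves_of_avg (hX : IsOrderIdeal X)
    (havg : ∀ F : CountablePartition, Preserves F.avg X) {T : L1I →L[ℝ] L1I}
    (hT : IsAdmissible T) : Preserves T X := fun x hx =>
  (normLeOn_of_avg (N := 0) hX (fun _ _ _ => le_rfl)
    (fun F x => ⟨havg F x x.2, by simp⟩) hT ⟨x, hx⟩).1

end Interpolation

end AveragingIdeals

open AveragingIdeals in
theorem theorem3p2 :
    -- Part I
    (∀ X : Submodule ℝ L1I, IsOrderIdeal X →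
      (∀ F : CountablePartition, Preserves F.avg X) →
        (∀ x ∈ X, ryffOrbit x ⊆ (X : Set L1I)) ∧ IsMajorantIdeal X) ∧
    -- Part II
    (∀ (X : Submodule ℝ L1I) (N : Seminorm ℝ X), IsBanachIdeal X N →
      (∀ F : CountablePartition, NormLeOn F.avg X N 1) →
        IsStronglyMajorant X N) ∧
    -- it suffices to test double stochastic projections
    (∀ X : Submodule ℝ L1I, IsOrderIdeal X →
      (IsMajorantIdeal X ↔
        ∀ P : L1I →L[ℝ] L1I, IsDoubleStochasticProjection P → Preserves P X)) ∧
    (∀ (X : Submodule ℝ L1I) (N : Seminorm ℝ X), IsBanachIdeal X N →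
      (IsStronglyMajorant X N ↔
        ∀ P : L1I →L[ℝ] L1I, IsDoubleStochasticProjection P → NormLeOn P X N 1)) := by
  have part1 : ∀ X : Submodule ℝ L1I, IsOrderIdeal X →
      (∀ F : CountablePartition, Preserves F.avg X) → IsMajorantIdeal X := fun X hX havg =>
    ⟨hX, fun T hT => preserves_of_avg hX havg hT⟩
  have part2 : ∀ (X : Submodule ℝ L1I) (N : Seminorm ℝ X), IsBanachIdeal X N →
      (∀ F : CountablePartition, NormLeOn F.avg X N 1) → IsStronglyMajorant X N :=
    fun X N hX havg => ⟨hX, fun T hT => normLeOn_of_avg hX.ideal hX.monotonic havg hT⟩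
  refine ⟨fun X hX havg => ⟨?_, part1 X hX havg⟩, part2, fun X hX => ⟨fun h P hP => ?_, fun h => ?_⟩,
    fun X N hX => ⟨fun h P hP => ?_, fun h => ?_⟩⟩
  · rintro x hx _ ⟨T, hT, rfl⟩
    exact (part1 X hX havg).interpolation T hT.admissible x hx
  · exact h.interpolation P hP.doubleStochastic.admissible
  · exact part1 X hX fun F => h _ F.isDoubleStochasticProjection_avg
  · exact (h.interpolation P hP.doubleStochastic.admissible).mono
      (max_le hP.doubleStochastic.enorm_le_one hP.doubleStochastic.supOpNorm_le_one)
  · exact part2 X N hX fun F => h _ F.isDoubleStochasticProjection_avg
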